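/- **Definitions.** A *certificate-selection instance* (CSI) is a finite tripartite graph $G$ on in-class datapoints $D_1\neq\emptyset$, certificates $C$ and out-class datapoints $D_{-1}\neq\emptyset$, with edges only between $D_1$ and $C$ and between $D_{-1}$ and $C$. A *prover* is a map $M:D_1\to C$ with $M(x)$ adjacent to $x$ for all $x$; a *verifier* is a map $A:C\to\{-1,1\}$. Put $$\mathrm{compl}(A,M)=\frac{|\{x\in D_1: A(M(x))=1\}|}{|D_1|},\qquad \mathrm{sound}(A)=\frac{|\{y\in D_{-1}: A(\phi)=-1\ \text{for all } \phi\in N(y)\}|}{|D_{-1}|},$$ $$\mathrm{Pr}(\phi)=\frac{|N(\phi)\cap D_1|}{|N(\phi)|},\qquad \mathrm{Pr}(M)=\frac1{|D_1|}\sum_{x\in D_1}\mathrm{Pr}(M(x)).$$ $G$ is an $(\epsilon_c,\epsilon_s)$-CSI if some prover $M$ and verifier $A$ satisfy $\mathrm{compl}(A,M)\ge 1-\epsilon_c$ and $\mathrm{sound}(A)\ge 1-\epsilon_s$. *Deceptive-Certificate-Selection-2* (DCS2): given rationals $\epsilon_c,\epsilon_s,q\ge 0$ and an $(\epsilon_c,\epsilon_s)$-CSI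 $G$, minimise $1-\mathrm{sound}(A)$ over the verifiers $A$ for which there is a prover $M$ with $\mathrm{compl}(A,M)\ge 1-\epsilon_c$ and $\mathrm{Pr}(M)\le 1-q$. An algorithm *approximates DCS2 within a factor* $g(m)$ if, on every instance that has an admissible verifier, it outputs an admissible verifier $A$ with $1-\mathrm{sound}(A)\le g(m)\,(1-\mathrm{sound}(A'))$ for every admissible $A'$, where $m=|C|$ is the number of certificates. *Hypergraph Dense-vs-Random conjecture*: for every constant integer $r$ and all constants $0<\beta<\alpha<r-1$ and $0<\gamma<1$ with $\gamma(1+\beta)\le(1+\alpha)/2$, writing $k=\lfloor n^\gamma\rfloor$ (so $k^{1+\beta}\le n^{(1+\alpha)/2}$), there is no (deterministic) polynomial-time algorithm that, given $n$, $k$ and an $r$-uniform hypergraph $H$ on $n$ vertices, (i) answers "random" with probability tending to $1$ as $n\to\infty$ when every $r$-set is an edge of $H$ independently with probability $n^{\alpha-(r-1)}$, and (ii) for all sufficiently large $n$, answers "dense" for every $H$ that has an induced subhypergraph on $k$ vertices of average degree at least $k^{\beta}$. **Statement.** Assume the Hypergraph Dense-vs-Random conjecture. Then for every $\epsilon>0$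 and every function $g(m)=O(m^{1/4-\epsilon})$, there is no (deterministic) polynomial-time algorithm that approximates DCS2 within a factor $g(m)$. -/

import Mathlib

open Filter Topology Asymptotics

noncomputable section

/-! ### Machine model: a random access machine with addition and truncated subtraction -/

namespace RAM

/-- Programs of a random access machine. Variables and arrays are named by natural numbers (a
program mentions only finitely many of them); they hold natural numbers. The only arithmetic is
addition and truncated subtraction, so that counting every instruction as one step is polynomially
equivalent to counting the steps of a Turing machine. -/
inductive Cmd : Type
  | skip : Cmd
  /-- `x := c` for a constant `c` -/
  | const (x c : ℕ) : Cmd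
  /-- `x := y + z` -/
  | add (x y z : ℕ) : Cmd
  /-- `x := y - z`, truncated at `0` -/
  | sub (x y z : ℕ) : Cmd
  /-- `x := a[i]` (`a` an array, `i` a variable) -/
  | load (x a i : ℕ) : Cmd
  /-- `a[i] := x` (`a` an array, `i` a variable) -/
  | store (a i x : ℕ) : Cmd
  | seq (c d : Cmd) : Cmd
  /-- if `x = 0` then `c` else `d` -/
  | ifZero (x : ℕ) (c d : Cmd) : Cmd
  /-- while `x ≠ 0` do `c` -/
  | whileNonzero (x : ℕ) (c : Cmd) : Cmd

/-- A memory state: the values of all variables and the contents of all arrays. -/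
@[ext]
structure State : Type where
  var : ℕ → ℕ
  arr : ℕ → ℕ → ℕ

/-- Assign the value `v` to the variable `x`. -/
def State.setVar (s : State) (x v : ℕ) : State :=
  { s with var := Function.update s.var x v }

/-- Assign the value `v` to the cell `i` of the array `a`. -/
def State.setArr (s : State) (a i v : ℕ) : State :=
  { s with arr := Function.update s.arr a (Function.update (s.arr a) i v) }

/-- `Exec c s t s'`: started in state `s`, the program `c` halts after exactly `t` steps, in state
`s'`. Every elementary instruction and every evaluation of a test is one step. -/
inductive Exec : Cmd → State → ℕ → State → Prop
  | skip (s : State) : Exec .skip s 1 s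
  | const (s : State) (x c : ℕ) : Exec (.const x c) s 1 (s.setVar x c)
  | add (s : State) (x y z : ℕ) : Exec (.add x y z) s 1 (s.setVar x (s.var y + s.var z))
  | sub (s : State) (x y z : ℕ) : Exec (.sub x y z) s 1 (s.setVar x (s.var y - s.var z))
  | load (s : State) (x a i : ℕ) : Exec (.load x a i) s 1 (s.setVar x (s.arr a (s.var i)))
  | store (s : State) (a i x : ℕ) : Exec (.store a i x) s 1 (s.setArr a (s.var i) (s.var x))
  | seq {c d : Cmd} {s s' s'' : State} {t t' : ℕ} :
      Exec c s t s' → Exec d s' t' s'' → Exec (.seq c d) s (t + t') s''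
  | ifZero_true {x : ℕ} {c d : Cmd} {s s' : State} {t : ℕ} :
      s.var x = 0 → Exec c s t s' → Exec (.ifZero x c d) s (t + 1) s'
  | ifZero_false {x : ℕ} {c d : Cmd} {s s' : State} {t : ℕ} :
      s.var x ≠ 0 → Exec d s t s' → Exec (.ifZero x c d) s (t + 1) s'
  | while_done {x : ℕ} {c : Cmd} {s : State} :
      s.var x = 0 → Exec (.whileNonzero x c) s 1 s
  | while_step {x : ℕ} {c : Cmd} {s s' s'' : State} {t t' : ℕ} :
      s.var x ≠ 0 → Exec c s t s' → Exec (.whileNonzero x c) s' t' s'' →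
      Exec (.whileNonzero x c) s (t + t' + 1) s''

/-- The initial state on input `w`: the word in array `0`, its length in variable `0`, and zeros
everywhere else. -/
def initState (w : List ℕ) : State where
  var x := if x = 0 then w.length else 0
  arr a i := if a = 0 then w.getD i 0 else 0

/-- The output: the first `var 0` cells of array `0`. -/
def State.output (s : State) : List ℕ :=
  (List.range (s.var 0)).map (s.arr 0)

/-- The size of a word of natural numbers: the total binary length of its entries, plus one for
each entry. -/
def inputSize (w : List ℕ) : ℕ :=
  (w.map fun x => Nat.size x + 1).sum

/-- `f` is computable in polynomial time when its arguments are presented through the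
encoding `enc`. -/
def PolyTimeComputable {α : Type} (enc : α → List ℕ) (f : α → List ℕ) : Prop :=
  ∃ (c : Cmd) (p : Polynomial ℕ), ∀ a : α, ∃ (t : ℕ) (s : State),
    t ≤ p.eval (inputSize (enc a)) ∧ Exec c (initState (enc a)) t s ∧ s.output = f a

end RAM

/-! ### The Hypergraph Dense-vs-Random conjecture -/

/-- `r`-uniform hypergraphs on the vertex set `{0, …, n - 1}`, given by their edge sets. -/
abbrev UniformHypergraph (r n : ℕ) : Type :=
  Finset {e : Finset (Fin n) // e.card = r}

namespace UniformHypergraph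

/-- The average degree of the subhypergraph induced on the vertex set `S`. -/
def avgDegree {r n : ℕ} (H : UniformHypergraph r n) (S : Finset (Fin n)) : ℝ :=
  ((∑ v ∈ S, (H.filter fun e => v ∈ e.1 ∧ e.1 ⊆ S).card : ℕ) : ℝ) / (S.card : ℝ)

/-- Some subhypergraph on `k` vertices has average degree at least `k ^ β`. -/
def HasDenseSub {r n : ℕ} (H : UniformHypergraph r n) (k : ℕ) (β : ℝ) : Prop :=
  ∃ S : Finset (Fin n), S.card = k ∧ (k : ℝ) ^ β ≤ H.avgDegree S

open Classical in
/-- The probability of the event `P` for the random `r`-uniform hypergraph on `n` vertices in which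
each `r`-set of vertices is an edge with probability `p`, independently of the others. -/
def randomProb (r n : ℕ) (p : ℝ) (P : UniformHypergraph r n → Prop) : ℝ :=
  ∑ H : UniformHypergraph r n, if P H then p ^ H.card * (1 - p) ^ (n.choose r - H.card) else 0

/-- The edges, each as the increasing list of its vertices, in a canonical order. -/
def edgeList {r n : ℕ} (H : UniformHypergraph r n) : List (List (Fin n)) :=
  ((List.finRange n).sublistsLen r).filter fun l => decide (∃ e ∈ H, e.1 = l.toFinset)

end UniformHypergraph

/-- Inputs of the hypergraph Dense-vs-Random problem. -/
structure DenseVsRandomInput (r : ℕ) : Type where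
  n : ℕ
  k : ℕ
  H : UniformHypergraph r n

/-- The encoding as a word: `n`, `k`, the number of edges, and the vertices of the edges. -/
def DenseVsRandomInput.encode {r : ℕ} (I : DenseVsRandomInput r) : List ℕ :=
  [I.n, I.k, I.H.card] ++ (I.H.edgeList.map fun l => l.map Fin.val).flatten

/-- A polynomial-time algorithm solves the Dense-vs-Random problem on `r`-uniform hypergraphs with
log-density `α`, planted log-density `β` and `k = ⌊n ^ γ⌋`: with high probability it answers
"random" (`false`) on the random hypergraph with edge probability `n ^ (α - (r - 1))`, and, for all
large `n`, it answers "dense" (`true`) on every hypergraph with a subhypergraph on `k` vertices of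
average degree at least `k ^ β`. -/
def DenseVsRandomSolvable (r : ℕ) (α β γ : ℝ) : Prop :=
  ∃ f : DenseVsRandomInput r → Bool,
    RAM.PolyTimeComputable DenseVsRandomInput.encode (fun I => [(f I).toNat]) ∧
    Tendsto (fun n : ℕ => UniformHypergraph.randomProb r n ((n : ℝ) ^ (α - ((r : ℝ) - 1)))
      fun H => f ⟨n, ⌊(n : ℝ) ^ γ⌋₊, H⟩ = false) atTop (𝓝 1) ∧
    ∀ᶠ n : ℕ in atTop, ∀ H : UniformHypergraph r n,
      H.HasDenseSub ⌊(n : ℝ) ^ γ⌋₊ β → f ⟨n, ⌊(n : ℝ) ^ γ⌋₊, H⟩ = true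

/-- The Hypergraph Dense-vs-Random conjecture: for every constant `r`, all log-densities
`0 < β < α < r - 1`, and `k = ⌊n ^ γ⌋` with `k ^ (1 + β) ≤ n ^ ((1 + α) / 2)`, the problem cannot be
solved in polynomial time. -/
def HypergraphDenseVsRandomConjecture : Prop :=
  ∀ (r : ℕ) (α β γ : ℝ), 0 < β → β < α → α < (r : ℝ) - 1 → 0 < γ → γ < 1 →
    γ * (1 + β) ≤ (1 + α) / 2 → ¬ DenseVsRandomSolvable r α β γ

/-! ### Certificate selection -/

/-- A certificate-selection instance: the tripartite graph on the in-class datapoints `D₁`, the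
certificates `C` and the out-class datapoints `D₀`, with edges only between datapoints and
certificates. -/
structure CSI (D₁ C D₀ : Type) : Type where
  inAdj : D₁ → C → Prop
  outAdj : D₀ → C → Prop

namespace CSI

variable {D₁ C D₀ : Type} [Fintype D₁] [Fintype D₀]

/-- `M` is a cooperative prover: it assigns to each in-class datapoint an adjacent certificate. -/
def IsProver (G : CSI D₁ C D₀) (M : D₁ → C) : Prop :=
  ∀ x, G.inAdj x (M x)

/-- The fraction of in-class datapoints whose certificate is accepted; a verifier is a map
`A : C → Bool`, with `true` for accept (`1`) and `false` for reject (`-1`). -/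
def completeness (A : C → Bool) (M : D₁ → C) : ℚ :=
  ((Finset.univ.filter fun x => A (M x) = true).card : ℚ) / (Fintype.card D₁ : ℚ)

open Classical in
/-- The fraction of out-class datapoints all of whose certificates are rejected. -/
def soundness (G : CSI D₁ C D₀) (A : C → Bool) : ℚ :=
  ((Finset.univ.filter fun y => ∀ φ, G.outAdj y φ → A φ = false).card : ℚ) /
    (Fintype.card D₀ : ℚ)

open Classical in
/-- The precision of a certificate: the fraction of its neighbours that are in-class. -/
def precision (G : CSI D₁ C D₀) (φ : C) : ℚ :=
  ((Finset.univ.filter fun x => G.inAdj x φ).card : ℚ) /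
    ((Finset.univ.filter fun x => G.inAdj x φ).card +
      (Finset.univ.filter fun y => G.outAdj y φ).card : ℚ)

/-- The average precision of a prover. -/
def avgPrecision (G : CSI D₁ C D₀) (M : D₁ → C) : ℚ :=
  (∑ x, G.precision (M x)) / (Fintype.card D₁ : ℚ)

/-- `G` is an `(εc, εs)`-certificate-selection instance. -/
def IsEpsCSI (G : CSI D₁ C D₀) (εc εs : ℚ) : Prop :=
  ∃ (M : D₁ → C) (A : C → Bool),
    G.IsProver M ∧ 1 - εc ≤ completeness A M ∧ 1 - εs ≤ G.soundness A

end CSI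

/-- Instances of Deceptive-Certificate-Selection-2, with `m` certificates. -/
structure DCS2Instance : Type where
  nIn : ℕ
  m : ℕ
  nOut : ℕ
  nIn_pos : 0 < nIn
  nOut_pos : 0 < nOut
  G : CSI (Fin nIn) (Fin m) (Fin nOut)
  εc : ℚ
  εs : ℚ
  q : ℚ
  εc_nonneg : 0 ≤ εc
  εs_nonneg : 0 ≤ εs
  q_nonneg : 0 ≤ q
  isEpsCSI : G.IsEpsCSI εc εs

namespace DCS2Instance

/-- The admissible verifiers: those for which some prover attains completeness at least `1 - εc`
and average precision at most `1 - q`. -/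
def Feasible (I : DCS2Instance) (A : Fin I.m → Bool) : Prop :=
  ∃ M : Fin I.nIn → Fin I.m,
    I.G.IsProver M ∧ 1 - I.εc ≤ CSI.completeness A M ∧ I.G.avgPrecision M ≤ 1 - I.q

open Classical in
/-- The encoding as a word: the sizes, the (numerators and denominators of the) constants, and the
two adjacency matrices, row by row. -/
def encode (I : DCS2Instance) : List ℕ :=
  [I.nIn, I.m, I.nOut, I.εc.num.toNat, I.εc.den, I.εs.num.toNat, I.εs.den, I.q.num.toNat, I.q.den]
    ++ (List.ofFn fun x : Fin I.nIn => List.ofFn fun φ : Fin I.m =>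
        if I.G.inAdj x φ then 1 else 0).flatten
    ++ (List.ofFn fun y : Fin I.nOut => List.ofFn fun φ : Fin I.m =>
        if I.G.outAdj y φ then 1 else 0).flatten

/-- The encoding of a verifier as a word of bits. -/
def encodeVerifier {m : ℕ} (A : Fin m → Bool) : List ℕ :=
  List.ofFn fun φ => (A φ).toNat

/-- Some polynomial-time algorithm approximates the problem of minimising `1 - soundness` over the
admissible verifiers within the factor `g m`, where `m` is the number of certificates: on each
instance that has an admissible verifier it outputs an admissible verifier whose objective value is
at most `g m` times that of every admissible verifier. -/
def PolyTimeApproximable (g : ℕ → ℝ) : Prop :=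
  ∃ f : DCS2Instance → List ℕ,
    RAM.PolyTimeComputable encode f ∧
    ∀ I : DCS2Instance, (∃ A', I.Feasible A') →
      ∃ A : Fin I.m → Bool, f I = encodeVerifier A ∧ I.Feasible A ∧
        ∀ A', I.Feasible A' →
          1 - (I.G.soundness A : ℝ) ≤ g I.m * (1 - (I.G.soundness A' : ℝ))

end DCS2Instance

end

/-!
The proof reduces the Dense-vs-Random problem for hypergraphs to DCS2.

Given a hypergraph `H` on `n` vertices, let its edges be certificates and its vertices out-class
datapoints, adjacent when the vertex lies on the edge. Accepting a set of edges then costs the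
fraction of the vertices that these edges cover. The in-class datapoints only serve to force the
verifier to accept at least `p` edges: every edge gets one in-class neighbour of its own, and one
additional certificate without out-class neighbours gets so many of them that completeness `1 / 2`
amounts to the acceptance of `p` edges (`gapInstance`). An approximation algorithm for DCS2 thus
approximates the least number of vertices covered by `p` edges.

For a small `θ > 0` take `k = ⌊n ^ (1 / 2 - θ)⌋`, `p = ⌊k ^ 4 / n⌋`, which is about
`n ^ (1 - 4 * θ)`, and log-densities `β = 1 - 4 * θ` and `α = 1 - 3 * θ`.
* If some `k` vertices span a subhypergraph of average degree `k ^ β`, they span at least `p` edges,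
  so that some `p` edges cover at most `k` vertices, and the algorithm finds `p` edges that cover at
  most `g m * k` vertices. As `m` is at most about `n ^ 2`, this is less than `p`
  (`eventually_parameters`, `DenseVsRandomInput.answer_eq_true`).
* In the random hypergraph of log-density `α`, with high probability any `p` edges cover at least
  `p` vertices, if the uniformity `r` is large in terms of `θ`. This is a union bound over the sets
  of `p - 1` vertices, in which the number of edges is controlled by its exponential moment
  (`UniformHypergraph.tendsto_randomProb_spread`, `DenseVsRandomInput.answer_eq_false`).

So comparing the number of covered vertices with `p` solves the Dense-vs-Random problem. The ratio
`n ^ (1 / 2) ≈ m ^ (1 / 4)` between `p` and `k` is where the exponent `1 / 4` comes from.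

That the reduction runs in polynomial time on the random access machine is shown with a small
language of arithmetic expressions with bounded sums (`RAM.Ex`). Expressions are compiled to
programs (`RAM.Ex.Below.compilesTo`), and their values and running times are polynomially bounded by
induction on the expression (`RAM.Ex.exists_poly_bound`). The approximation algorithm is used as a
subroutine by means of a frame property of programs (`RAM.Exec.frame`).
-/

noncomputable section

namespace RAM

/-! ### Locality of programs -/

/-- Two memory states agree on the variables in `X` and on the arrays in `R`. -/
def State.AgreeOn (X R : ℕ → Prop) (s u : State) : Prop :=
  (∀ x, X x → s.var x = u.var x) ∧ ∀ a, R a → s.arr a = u.arr a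

namespace State.AgreeOn

variable {X R X' R' : ℕ → Prop} {s u v : State}

theorem refl (s : State) : s.AgreeOn X R s := ⟨fun _ _ => rfl, fun _ _ => rfl⟩

theorem symm (h : s.AgreeOn X R u) : u.AgreeOn X R s :=
  ⟨fun x hx => (h.1 x hx).symm, fun a ha => (h.2 a ha).symm⟩

theorem trans (h : s.AgreeOn X R u) (h' : u.AgreeOn X R v) : s.AgreeOn X R v :=
  ⟨fun x hx => (h.1 x hx).trans (h'.1 x hx), fun a ha => (h.2 a ha).trans (h'.2 a ha)⟩

theorem mono (h : s.AgreeOn X R u) (hX : ∀ x, X' x → X x) (hR : ∀ a, R' a → R a) :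
    s.AgreeOn X' R' u :=
  ⟨fun x hx => h.1 x (hX x hx), fun a ha => h.2 a (hR a ha)⟩

theorem setVar (h : s.AgreeOn X R u) (x v : ℕ) :
    (s.setVar x v).AgreeOn (fun y => y = x ∨ X y) R (u.setVar x v) := by
  refine ⟨fun y hy => ?_, h.2⟩
  by_cases hyx : y = x
  · simp [State.setVar, hyx]
  · simpa [State.setVar, hyx] using h.1 y (hy.resolve_left hyx)

theorem setVar' (h : s.AgreeOn X R u) (x v : ℕ) :
    (s.setVar x v).AgreeOn X R (u.setVar x v) :=
  (h.setVar x v).mono (fun _ hy => Or.inr hy) fun _ ha => ha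

theorem setArr (h : s.AgreeOn X R u) (a i v : ℕ) :
    (s.setArr a i v).AgreeOn X R (u.setArr a i v) := by
  refine ⟨h.1, fun b hb => ?_⟩
  by_cases hba : b = a
  · subst hba; simp [State.setArr, h.2 b hb]
  · simpa [State.setArr, hba] using h.2 b hb

theorem setVar_right (h : s.AgreeOn X R u) {x : ℕ} (hx : ¬ X x) (v : ℕ) :
    s.AgreeOn X R (u.setVar x v) := by
  refine ⟨fun y hy => ?_, h.2⟩
  have : y ≠ x := fun e => hx (e ▸ hy)
  simpa [State.setVar, this] using h.1 y hy

theorem setArr_right (h : s.AgreeOn X R u) {a : ℕ} (ha : ¬ R a) (i v : ℕ) :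
    s.AgreeOn X R (u.setArr a i v) := by
  refine ⟨h.1, fun b hb => ?_⟩
  have : b ≠ a := fun e => ha (e ▸ hb)
  simpa [State.setArr, this] using h.2 b hb

end State.AgreeOn

/-- All variables and arrays mentioned by the program have names below `K`. -/
def Cmd.NamesLt (K : ℕ) : Cmd → Prop
  | .skip => True
  | .const x _ => x < K
  | .add x y z => x < K ∧ y < K ∧ z < K
  | .sub x y z => x < K ∧ y < K ∧ z < K
  | .load x a i => x < K ∧ a < K ∧ i < K
  | .store a i x => a < K ∧ i < K ∧ x < K
  | .seq c d => c.NamesLt K ∧ d.NamesLt K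
  | .ifZero x c d => x < K ∧ c.NamesLt K ∧ d.NamesLt K
  | .whileNonzero x c => x < K ∧ c.NamesLt K

theorem Cmd.NamesLt.mono {K K' : ℕ} (h : K ≤ K') : ∀ {c : Cmd}, c.NamesLt K → c.NamesLt K'
  | .skip, _ => trivial
  | .const _ _, hc => lt_of_lt_of_le hc h
  | .add _ _ _, hc => ⟨hc.1.trans_le h, hc.2.1.trans_le h, hc.2.2.trans_le h⟩
  | .sub _ _ _, hc => ⟨hc.1.trans_le h, hc.2.1.trans_le h, hc.2.2.trans_le h⟩
  | .load _ _ _, hc => ⟨hc.1.trans_le h, hc.2.1.trans_le h, hc.2.2.trans_le h⟩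
  | .store _ _ _, hc => ⟨hc.1.trans_le h, hc.2.1.trans_le h, hc.2.2.trans_le h⟩
  | .seq _ _, hc => ⟨hc.1.mono h, hc.2.mono h⟩
  | .ifZero _ _ _, hc => ⟨hc.1.trans_le h, hc.2.1.mono h, hc.2.2.mono h⟩
  | .whileNonzero _ _, hc => ⟨hc.1.trans_le h, hc.2.mono h⟩

theorem Cmd.exists_namesLt : ∀ c : Cmd, ∃ K, c.NamesLt K
  | .skip => ⟨0, trivial⟩
  | .const x _ => ⟨x + 1, Nat.lt_succ_self x⟩
  | .add x y z => ⟨x + y + z + 1, by simp only [Cmd.NamesLt]; omega⟩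
  | .sub x y z => ⟨x + y + z + 1, by simp only [Cmd.NamesLt]; omega⟩
  | .load x y z => ⟨x + y + z + 1, by simp only [Cmd.NamesLt]; omega⟩
  | .store x y z => ⟨x + y + z + 1, by simp only [Cmd.NamesLt]; omega⟩
  | .seq c d => by
    obtain ⟨K, hK⟩ := exists_namesLt c
    obtain ⟨K', hK'⟩ := exists_namesLt d
    exact ⟨K + K', hK.mono (by omega), hK'.mono (by omega)⟩
  | .ifZero x c d => by
    obtain ⟨K, hK⟩ := exists_namesLt c
    obtain ⟨K', hK'⟩ := exists_namesLt d
    exact ⟨K + K' + x + 1, by omega, hK.mono (by omega), hK'.mono (by omega)⟩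
  | .whileNonzero x c => by
    obtain ⟨K, hK⟩ := exists_namesLt c
    exact ⟨K + x + 1, by omega, hK.mono (by omega)⟩

/-- A program whose names lie below `K` runs in the same way from every state with the same memory
below `K`, and leaves the rest of the memory alone. -/
theorem Exec.frame {c : Cmd} {s s' : State} {t K : ℕ} (h : Exec c s t s') (hc : c.NamesLt K) :
    ∀ u, s.AgreeOn (· < K) (· < K) u →
      ∃ u', Exec c u t u' ∧ s'.AgreeOn (· < K) (· < K) u' ∧ u.AgreeOn (K ≤ ·) (K ≤ ·) u' := by
  induction h with
  | skip s => exact fun u hu => ⟨u, .skip u, hu, .refl u⟩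
  | const s x c =>
    exact fun u hu => ⟨_, .const u x c, hu.setVar' _ _,
      (State.AgreeOn.refl u).setVar_right (not_le.2 hc) _⟩
  | add s x y z =>
    intro u hu
    refine ⟨_, .add u x y z, ?_, (State.AgreeOn.refl u).setVar_right (not_le.2 hc.1) _⟩
    rw [hu.1 y hc.2.1, hu.1 z hc.2.2]
    exact hu.setVar' _ _
  | sub s x y z =>
    intro u hu
    refine ⟨_, .sub u x y z, ?_, (State.AgreeOn.refl u).setVar_right (not_le.2 hc.1) _⟩
    rw [hu.1 y hc.2.1, hu.1 z hc.2.2]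
    exact hu.setVar' _ _
  | load s x a i =>
    intro u hu
    refine ⟨_, .load u x a i, ?_, (State.AgreeOn.refl u).setVar_right (not_le.2 hc.1) _⟩
    rw [hu.2 a hc.2.1, hu.1 i hc.2.2]
    exact hu.setVar' _ _
  | store s a i x =>
    intro u hu
    refine ⟨_, .store u a i x, ?_, (State.AgreeOn.refl u).setArr_right (not_le.2 hc.1) _ _⟩
    rw [hu.1 x hc.2.2, hu.1 i hc.2.1]
    exact hu.setArr _ _ _
  | seq _ _ ih₁ ih₂ =>
    intro u hu
    obtain ⟨u₁, e₁, a₁, b₁⟩ := ih₁ hc.1 u hu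
    obtain ⟨u₂, e₂, a₂, b₂⟩ := ih₂ hc.2 u₁ a₁
    exact ⟨u₂, .seq e₁ e₂, a₂, b₁.trans b₂⟩
  | ifZero_true hx _ ih =>
    intro u hu
    obtain ⟨u₁, e₁, a₁, b₁⟩ := ih hc.2.1 u hu
    exact ⟨u₁, .ifZero_true (hu.1 _ hc.1 ▸ hx) e₁, a₁, b₁⟩
  | ifZero_false hx _ ih =>
    intro u hu
    obtain ⟨u₁, e₁, a₁, b₁⟩ := ih hc.2.2 u hu
    exact ⟨u₁, .ifZero_false (hu.1 _ hc.1 ▸ hx) e₁, a₁, b₁⟩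
  | while_done hx => exact fun u hu => ⟨u, .while_done (hu.1 _ hc.1 ▸ hx), hu, .refl u⟩
  | while_step hx _ _ ih₁ ih₂ =>
    intro u hu
    obtain ⟨u₁, e₁, a₁, b₁⟩ := ih₁ hc.2 u hu
    obtain ⟨u₂, e₂, a₂, b₂⟩ := ih₂ hc u₁ a₁
    exact ⟨u₂, .while_step (hu.1 _ hc.1 ▸ hx) e₁ e₂, a₂, b₁.trans b₂⟩

/-! ### Arithmetic expressions with bounded sums -/

/-- Arithmetic expressions over the memory, closed under bounded summation. Products, quotients and
bounded quantifiers are instances of bounded sums. -/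
inductive Ex : Type
  | var (x : ℕ) : Ex
  | lit (c : ℕ) : Ex
  | add (e f : Ex) : Ex
  | sub (e f : Ex) : Ex
  /-- the cell `a[e]` -/
  | arr (a : ℕ) (e : Ex) : Ex
  /-- if `e = 0` then `f` else `g` -/
  | ite (e f g : Ex) : Ex
  /-- the sum of `f` over all values `x = 0, …, e - 1` of the bound variable `x` -/
  | sum (x : ℕ) (e f : Ex) : Ex

namespace Ex

/-- The value of an expression; subtraction is truncated. -/
def eval : Ex → State → ℕ
  | .var x, s => s.var x
  | .lit c, _ => c
  | .add e f, s => e.eval s + f.eval s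
  | .sub e f, s => e.eval s - f.eval s
  | .arr a e, s => s.arr a (e.eval s)
  | .ite e f g, s => if e.eval s = 0 then f.eval s else g.eval s
  | .sum x e f, s => ∑ i ∈ Finset.range (e.eval s), f.eval (s.setVar x i)

/-- The number of steps taken by the compiled expression. -/
def cost : Ex → State → ℕ
  | .var _, _ => 2
  | .lit _, _ => 1
  | .add e f, s => e.cost s + f.cost s + 1
  | .sub e f, s => e.cost s + f.cost s + 1
  | .arr _ e, s => e.cost s + 1
  | .ite e f g, s => e.cost s + (if e.eval s = 0 then f.cost s else g.cost s) + 1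
  | .sum x e f, s => e.cost s + ∑ i ∈ Finset.range (e.eval s), (f.cost (s.setVar x i) + 7) + 7

/-- All variables of the expression, free or bound, have names below `d`. -/
def Below (d : ℕ) : Ex → Prop
  | .var x => x < d
  | .lit _ => True
  | .add e f => e.Below d ∧ f.Below d
  | .sub e f => e.Below d ∧ f.Below d
  | .arr _ e => e.Below d
  | .ite e f g => e.Below d ∧ f.Below d ∧ g.Below d
  | .sum x e f => x < d ∧ e.Below d ∧ f.Below d

/-- The free variables of the expression lie in `X`, and its arrays in `R`. -/
def Uses (R : ℕ → Prop) : (ℕ → Prop) → Ex → Prop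
  | X, .var x => X x
  | _, .lit _ => True
  | X, .add e f => e.Uses R X ∧ f.Uses R X
  | X, .sub e f => e.Uses R X ∧ f.Uses R X
  | X, .arr a e => R a ∧ e.Uses R X
  | X, .ite e f g => e.Uses R X ∧ f.Uses R X ∧ g.Uses R X
  | X, .sum x e f => e.Uses R X ∧ f.Uses R fun y => y = x ∨ X y

theorem Below.mono {d d' : ℕ} (h : d ≤ d') : ∀ {e : Ex}, e.Below d → e.Below d'
  | .var _, he => lt_of_lt_of_le he h
  | .lit _, _ => trivial
  | .add _ _, he => ⟨he.1.mono h, he.2.mono h⟩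
  | .sub _ _, he => ⟨he.1.mono h, he.2.mono h⟩
  | .arr _ e, he => Below.mono (e := e) h he
  | .ite _ _ _, he => ⟨he.1.mono h, he.2.1.mono h, he.2.2.mono h⟩
  | .sum _ _ _, he => ⟨he.1.trans_le h, he.2.1.mono h, he.2.2.mono h⟩

theorem Uses.mono {R R' : ℕ → Prop} (hR : ∀ a, R a → R' a) :
    ∀ {e : Ex} {X X' : ℕ → Prop}, (∀ x, X x → X' x) → e.Uses R X → e.Uses R' X'
  | .var _, _, _, h, he => h _ he
  | .lit _, _, _, _, _ => trivial
  | .add _ _, _, _, h, he => ⟨he.1.mono hR h, he.2.mono hR h⟩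
  | .sub _ _, _, _, h, he => ⟨he.1.mono hR h, he.2.mono hR h⟩
  | .arr _ _, _, _, h, he => ⟨hR _ he.1, he.2.mono hR h⟩
  | .ite _ _ _, _, _, h, he => ⟨he.1.mono hR h, he.2.1.mono hR h, he.2.2.mono hR h⟩
  | .sum _ _ _, _, _, h, he => ⟨he.1.mono hR h, he.2.mono hR fun _ hy => hy.imp_right (h _)⟩

theorem Uses.inter {R R' : ℕ → Prop} : ∀ {e : Ex} {X X' : ℕ → Prop}, e.Uses R X → e.Uses R' X' →
    e.Uses (fun a => R a ∧ R' a) X'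
  | .var _, _, _, _, h' => h'
  | .lit _, _, _, _, _ => trivial
  | .add _ _, _, _, h, h' => ⟨h.1.inter h'.1, h.2.inter h'.2⟩
  | .sub _ _, _, _, h, h' => ⟨h.1.inter h'.1, h.2.inter h'.2⟩
  | .arr _ _, _, _, h, h' => ⟨⟨h.1, h'.1⟩, h.2.inter h'.2⟩
  | .ite _ _ _, _, _, h, h' => ⟨h.1.inter h'.1, h.2.1.inter h'.2.1, h.2.2.inter h'.2.2⟩
  | .sum _ _ _, _, _, h, h' => ⟨h.1.inter h'.1, h.2.inter h'.2⟩

theorem Below.uses {d : ℕ} : ∀ {e : Ex}, e.Below d → e.Uses (fun _ => True) (· < d)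
  | .var _, he => he
  | .lit _, _ => trivial
  | .add _ _, he => ⟨he.1.uses, he.2.uses⟩
  | .sub _ _, he => ⟨he.1.uses, he.2.uses⟩
  | .arr _ e, he => ⟨trivial, Below.uses (e := e) he⟩
  | .ite _ _ _, he => ⟨he.1.uses, he.2.1.uses, he.2.2.uses⟩
  | .sum _ _ _, he => ⟨he.2.1.uses, he.2.2.uses.mono (fun _ h => h) fun _ => Or.inr⟩

theorem eval_congr {R : ℕ → Prop} : ∀ {e : Ex} {X : ℕ → Prop} {s u : State},
    e.Uses R X → s.AgreeOn X R u → e.eval s = e.eval u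
  | .var x, _, _, _, he, h => h.1 x he
  | .lit _, _, _, _, _, _ => rfl
  | .add _ _, _, _, _, he, h => by simp only [eval, eval_congr he.1 h, eval_congr he.2 h]
  | .sub _ _, _, _, _, he, h => by simp only [eval, eval_congr he.1 h, eval_congr he.2 h]
  | .arr a _, _, _, _, he, h => by simp only [eval, eval_congr he.2 h, h.2 a he.1]
  | .ite _ _ _, _, _, _, he, h => by
    simp only [eval, eval_congr he.1 h, eval_congr he.2.1 h, eval_congr he.2.2 h]
  | .sum x _ _, _, _, _, he, h => by
    simp only [eval, eval_congr he.1 h]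
    exact Finset.sum_congr rfl fun i _ => eval_congr he.2 (h.setVar x i)

theorem cost_congr {R : ℕ → Prop} : ∀ {e : Ex} {X : ℕ → Prop} {s u : State},
    e.Uses R X → s.AgreeOn X R u → e.cost s = e.cost u
  | .var _, _, _, _, _, _ => rfl
  | .lit _, _, _, _, _, _ => rfl
  | .add _ _, _, _, _, he, h => by simp only [cost, cost_congr he.1 h, cost_congr he.2 h]
  | .sub _ _, _, _, _, he, h => by simp only [cost, cost_congr he.1 h, cost_congr he.2 h]
  | .arr a _, _, _, _, he, h => by simp only [cost, cost_congr he.2 h]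
  | .ite _ _ _, _, _, _, he, h => by
    simp only [cost, eval_congr he.1 h, cost_congr he.1 h, cost_congr he.2.1 h,
      cost_congr he.2.2 h]
  | .sum x _ _, _, _, _, he, h => by
    simp only [cost, eval_congr he.1 h, cost_congr he.1 h]
    congr 2
    exact Finset.sum_congr rfl fun i _ => by rw [cost_congr he.2 (h.setVar x i)]

theorem eval_setVar {e : Ex} {d x : ℕ} (he : e.Below d) (hx : d ≤ x) (s : State) (v : ℕ) :
    e.eval (s.setVar x v) = e.eval s :=
  eval_congr he.uses
    ((State.AgreeOn.refl s).setVar_right (X := (· < d)) (not_lt.2 hx) v).symm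

/-- The copy instruction `x := y`, for `x ≠ y`. -/
def copy (x y : ℕ) : Cmd := .seq (.const x 0) (.add x x y)

/-- The program that evaluates an expression into the variable `d`, using the variables from `d`
on as scratch space. The bound variable of a sum is saved before the loop and restored after it. -/
def compile : Ex → ℕ → Cmd
  | .var x, d => copy d x
  | .lit c, d => .const d c
  | .add e f, d => .seq (e.compile d) (.seq (f.compile (d + 1)) (.add d d (d + 1)))
  | .sub e f, d => .seq (e.compile d) (.seq (f.compile (d + 1)) (.sub d d (d + 1)))
  | .arr a e, d => .seq (e.compile d) (.load d a d)
  | .ite e f g, d => .seq (e.compile d) (.ifZero d (f.compile d) (g.compile d))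
  | .sum x e f, d =>
    .seq (e.compile (d + 1)) (.seq (.const d 0) (.seq (.const (d + 2) 0) (.seq (copy (d + 3) x)
      (.seq
        (.whileNonzero (d + 1)
          (.seq (copy x (d + 2)) (.seq (f.compile (d + 4)) (.seq (.add d d (d + 4))
            (.seq (.const (d + 4) 1)
              (.seq (.add (d + 2) (d + 2) (d + 4)) (.sub (d + 1) (d + 1) (d + 4))))))))
        (copy x (d + 3))))))

end Ex

theorem exec_copy (s : State) {x y : ℕ} (h : x ≠ y) :
    Exec (Ex.copy x y) s 2 (s.setVar x (s.var y)) := by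
  have e : (s.setVar x 0).setVar x ((s.setVar x 0).var x + (s.setVar x 0).var y) =
      s.setVar x (s.var y) := by
    ext z
    · by_cases hz : z = x <;> simp [State.setVar, hz, h.symm]
    · rfl
  exact e ▸ Exec.seq (Exec.const s x 0) (Exec.add (s.setVar x 0) x x y)

theorem State.agreeOn_setVar (s : State) {d x : ℕ} {R : ℕ → Prop} (hx : d ≤ x) (v : ℕ) :
    (s.setVar x v).AgreeOn (· < d) R s :=
  ((State.AgreeOn.refl s).setVar_right (X := (· < d)) (not_lt.2 hx) v).symm

@[simp] theorem State.setVar_var (s : State) (x v y : ℕ) :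
    (s.setVar x v).var y = if y = x then v else s.var y := by
  simp [State.setVar, Function.update_apply]

@[simp] theorem State.setVar_arr (s : State) (x v : ℕ) : (s.setVar x v).arr = s.arr := rfl

end RAM

namespace RAM

theorem Exec.cast {c : Cmd} {s s' : State} {t t' : ℕ} (h : Exec c s t s') (e : t = t') :
    Exec c s t' s' := e ▸ h

namespace Ex

/-- The compiled expression halts after exactly `cost` steps with the value in the variable `d`, and
changes neither the variables below `d` nor the arrays. -/
def CompilesTo (e : Ex) (d : ℕ) : Prop :=
  ∀ s : State, ∃ s', Exec (e.compile d) s (e.cost s) s' ∧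
    s'.AgreeOn (· < d) (fun _ => True) s ∧ s'.var d = e.eval s

/-- The loop of a compiled sum, when the index has reached `i` and `m` rounds are left. -/
theorem sum_loop_exec {x d : ℕ} {f : Ex} (hx : x < d) (hf : f.Below d)
    (hc : f.CompilesTo (d + 4)) (s : State) : ∀ (m i : ℕ) (u : State),
    u.AgreeOn (fun y => y < d ∧ y ≠ x) (fun _ => True) s → u.var (d + 1) = m →
    u.var (d + 2) = i →
    ∃ u', Exec (.whileNonzero (d + 1)
          (.seq (copy x (d + 2)) (.seq (f.compile (d + 4)) (.seq (.add d d (d + 4))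
            (.seq (.const (d + 4) 1)
              (.seq (.add (d + 2) (d + 2) (d + 4)) (.sub (d + 1) (d + 1) (d + 4)))))))) u
        (∑ j ∈ Finset.range m, (f.cost (s.setVar x (i + j)) + 7) + 1) u' ∧
      u'.AgreeOn (fun y => y < d ∧ y ≠ x) (fun _ => True) s ∧
      u'.var d = u.var d + ∑ j ∈ Finset.range m, f.eval (s.setVar x (i + j)) ∧
      u'.var (d + 3) = u.var (d + 3) := by
  intro m
  induction m with
  | zero => exact fun i u hu hm _ => ⟨u, by simpa using Exec.while_done hm, hu, by simp, rfl⟩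
  | succ m ih =>
    intro i u hu hm hi
    have e1 := exec_copy u (show x ≠ d + 2 by omega)
    rw [hi] at e1
    obtain ⟨v, e2, a2, v2⟩ := hc (u.setVar x i)
    have hag : (u.setVar x i).AgreeOn (· < d) (fun _ => True) (s.setVar x i) :=
      (hu.setVar x i).mono (fun y hy => by tauto) fun _ h => h
    rw [cost_congr hf.uses hag] at e2
    rw [eval_congr hf.uses hag] at v2
    have e3 := Exec.add v d d (d + 4)
    set v3 := v.setVar d (v.var d + v.var (d + 4)) with hv3
    have e4 := Exec.const v3 (d + 4) 1
    set v4 := v3.setVar (d + 4) 1 with hv4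
    have e5 := Exec.add v4 (d + 2) (d + 2) (d + 4)
    set v5 := v4.setVar (d + 2) (v4.var (d + 2) + v4.var (d + 4)) with hv5
    have e6 := Exec.sub v5 (d + 1) (d + 1) (d + 4)
    set v6 := v5.setVar (d + 1) (v5.var (d + 1) - v5.var (d + 4)) with hv6
    have w0 : v.var d = u.var d := by
      rw [a2.1 d (by omega)]; simp [show d ≠ x by omega]
    have w1 : v.var (d + 1) = m + 1 := by
      rw [a2.1 (d + 1) (by omega)]; simp [show d + 1 ≠ x by omega, hm]
    have w2 : v.var (d + 2) = i := by
      rw [a2.1 (d + 2) (by omega)]; simp [show d + 2 ≠ x by omega, hi]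
    have w3 : v.var (d + 3) = u.var (d + 3) := by
      rw [a2.1 (d + 3) (by omega)]; simp [show d + 3 ≠ x by omega]
    have hv6a : v6.AgreeOn (fun y => y < d ∧ y ≠ x) (fun _ => True) s := by
      refine ⟨fun y hy => ?_, fun a _ => ?_⟩
      · have := a2.1 y (by omega)
        simp only [State.setVar_var, hy.2, if_false] at this
        have h1 : y ≠ d := by omega
        have h2 : y ≠ d + 4 := by omega
        have h3 : y ≠ d + 2 := by omega
        have h4 : y ≠ d + 1 := by omega
        simp only [hv6, hv5, hv4, hv3, State.setVar_var, h1, h2, h3, h4, if_false]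
        exact this.trans (hu.1 y hy)
      · simp [hv6, hv5, hv4, hv3, a2.2 a trivial, hu.2 a trivial]
    obtain ⟨u', e7, a7, r7, t7⟩ := ih (i + 1) v6 hv6a
      (by simp [hv6, hv5, hv4, hv3, w1]) (by simp [hv6, hv5, hv4, hv3, w2])
    refine ⟨u', ?_, a7, ?_, ?_⟩
    · refine (Exec.while_step (by omega)
        (e1.seq (e2.seq (e3.seq (e4.seq (e5.seq e6))))) e7).cast ?_
      have hsum : ∑ j ∈ Finset.range m, (f.cost (s.setVar x (i + 1 + j)) + 7) =
          ∑ j ∈ Finset.range m, (f.cost (s.setVar x (i + (j + 1))) + 7) :=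
        Finset.sum_congr rfl fun j _ => by rw [show i + (j + 1) = i + 1 + j by omega]
      rw [Finset.sum_range_succ' _ m, hsum, add_zero]
      omega
    · rw [r7, Finset.sum_range_succ' _ m]
      simp [hv6, hv5, hv4, hv3, w0, v2, add_assoc, add_comm, add_left_comm]
    · rw [t7]
      simp [hv6, hv5, hv4, hv3, w3]

theorem Below.compilesTo : ∀ {e : Ex} {d : ℕ}, e.Below d → e.CompilesTo d
  | .var x, d, he, s =>
    ⟨_, exec_copy s (Nat.ne_of_gt he), s.agreeOn_setVar le_rfl _, by simp [eval]⟩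
  | .lit c, d, _, s => ⟨_, .const s d c, s.agreeOn_setVar le_rfl _, by simp [eval]⟩
  | .add e f, d, he, s => by
    obtain ⟨u, e1, a1, v1⟩ := Below.compilesTo he.1 s
    obtain ⟨v, e2, a2, v2⟩ := Below.compilesTo (he.2.mono (Nat.le_succ d)) u
    rw [cost_congr he.2.uses a1] at e2
    rw [eval_congr he.2.uses a1] at v2
    refine ⟨_, (e1.seq (e2.seq (.add v d d (d + 1)))).cast (add_assoc _ _ _).symm,
      (v.agreeOn_setVar le_rfl _).trans ((a2.mono (fun y hy => ?_) fun _ h => h).trans a1), ?_⟩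
    · omega
    · simp [eval, v2, a2.1 d (by omega), v1]
  | .sub e f, d, he, s => by
    obtain ⟨u, e1, a1, v1⟩ := Below.compilesTo he.1 s
    obtain ⟨v, e2, a2, v2⟩ := Below.compilesTo (he.2.mono (Nat.le_succ d)) u
    rw [cost_congr he.2.uses a1] at e2
    rw [eval_congr he.2.uses a1] at v2
    refine ⟨_, (e1.seq (e2.seq (.sub v d d (d + 1)))).cast (add_assoc _ _ _).symm,
      (v.agreeOn_setVar le_rfl _).trans ((a2.mono (fun y hy => ?_) fun _ h => h).trans a1), ?_⟩
    · omega
    · simp [eval, v2, a2.1 d (by omega), v1]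
  | .arr a e, d, he, s => by
    obtain ⟨u, e1, a1, v1⟩ := Below.compilesTo (e := e) he s
    refine ⟨_, e1.seq (.load u d a d), (u.agreeOn_setVar le_rfl _).trans a1, ?_⟩
    simp [eval, v1, a1.2 a trivial]
  | .ite c f g, d, he, s => by
    obtain ⟨u, e1, a1, v1⟩ := Below.compilesTo he.1 s
    by_cases h0 : c.eval s = 0
    · obtain ⟨v, e2, a2, v2⟩ := Below.compilesTo he.2.1 u
      rw [cost_congr he.2.1.uses a1] at e2
      rw [eval_congr he.2.1.uses a1] at v2
      exact ⟨v, (e1.seq (.ifZero_true (v1.trans h0) e2)).cast (by simp [cost, h0, add_assoc]),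
        a2.trans a1, by simp [eval, h0, v2]⟩
    · obtain ⟨v, e2, a2, v2⟩ := Below.compilesTo he.2.2 u
      rw [cost_congr he.2.2.uses a1] at e2
      rw [eval_congr he.2.2.uses a1] at v2
      exact ⟨v, (e1.seq (.ifZero_false (by rwa [v1]) e2)).cast (by simp [cost, h0, add_assoc]),
        a2.trans a1, by simp [eval, h0, v2]⟩
  | .sum x e f, d, he, s => by
    obtain ⟨hx, he, hf⟩ := he
    obtain ⟨u, e1, a1, v1⟩ := Below.compilesTo (he.mono (Nat.le_succ d)) s
    have e2 := Exec.const u d 0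
    set u2 := u.setVar d 0 with hu2
    have e3 := Exec.const u2 (d + 2) 0
    set u3 := u2.setVar (d + 2) 0 with hu3
    have e4 := exec_copy u3 (show d + 3 ≠ x by omega)
    set u4 := u3.setVar (d + 3) (u3.var x) with hu4
    have a4 : u4.AgreeOn (· < d) (fun _ => True) s :=
      (u3.agreeOn_setVar (by omega) _).trans ((u2.agreeOn_setVar (by omega) _).trans
        ((u.agreeOn_setVar le_rfl _).trans (a1.mono (fun y hy => by omega) fun _ h => h)))
    obtain ⟨v, e5, a5, v5, w5⟩ := sum_loop_exec hx hf (Below.compilesTo (hf.mono (by omega))) s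
      (e.eval s) 0 u4 (a4.mono (fun y hy => hy.1) fun _ h => h)
      (by simp [hu4, hu3, hu2, v1]) (by simp [hu4, hu3])
    have e6 := exec_copy v (show x ≠ d + 3 by omega)
    refine ⟨_, (e1.seq (e2.seq (e3.seq (e4.seq (e5.seq e6))))).cast ?_, ⟨fun y hy => ?_, ?_⟩, ?_⟩
    · simp only [cost, zero_add]; omega
    · by_cases hyx : y = x
      · have hxd : x ≠ d := by omega
        have hxd2 : x ≠ d + 2 := by omega
        simp [hyx, w5, hu4, hu3, hu2, hxd, hxd2, a1.1 x (by omega)]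
      · simp [hyx, a5.1 y ⟨hy, hyx⟩]
    · exact a5.2
    · simp [eval, v5, show d ≠ x by omega, hu4, hu3, hu2]

end Ex

/-! ### Straight-line programs over expressions -/

/-- From every state with the same arrays and the same variables below `d` as `s`, the program `c`
halts within `T` steps in a state that agrees likewise with `s'`. The variables from `d` on are
scratch space. -/
def RunsTo (d : ℕ) (c : Cmd) (s : State) (T : ℕ) (s' : State) : Prop :=
  ∀ u : State, u.AgreeOn (· < d) (fun _ => True) s →
    ∃ t ≤ T, ∃ u', Exec c u t u' ∧ u'.AgreeOn (· < d) (fun _ => True) s'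

theorem RunsTo.seq {d : ℕ} {c c' : Cmd} {s s' s'' : State} {T T' : ℕ} (h : RunsTo d c s T s')
    (h' : RunsTo d c' s' T' s'') : RunsTo d (.seq c c') s (T + T') s'' := by
  intro u hu
  obtain ⟨t, ht, v, e, a⟩ := h u hu
  obtain ⟨t', ht', v', e', a'⟩ := h' v a
  exact ⟨t + t', by omega, v', e.seq e', a'⟩

/-- The program `x := e`, with scratch space from `d` on. -/
def assign (d x : ℕ) (e : Ex) : Cmd := .seq (e.compile d) (Ex.copy x d)

theorem runsTo_assign {d x : ℕ} {e : Ex} (hx : x < d) (he : e.Below d) (s : State) :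
    RunsTo d (assign d x e) s (e.cost s + 2) (s.setVar x (e.eval s)) := by
  intro u hu
  obtain ⟨v, e1, a1, v1⟩ := he.compilesTo u
  rw [Ex.eval_congr he.uses hu] at v1
  rw [Ex.cost_congr he.uses hu] at e1
  refine ⟨_, le_rfl, _, e1.seq (exec_copy v hx.ne), ?_⟩
  rw [v1]
  exact (a1.trans hu).setVar' x _

/-- The state after `a[j] := e(j)` for all `j < m`, where the variable `x` stands for `j`. -/
def State.fill (s : State) (a x m : ℕ) (e : Ex) : State :=
  { s with arr := Function.update s.arr a fun j =>
      if j < m then e.eval (s.setVar x j) else s.arr a j }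

/-- The program `for x < l do a[x] := e`, with scratch space from `d` on. -/
def fill (d a x : ℕ) (l e : Ex) : Cmd :=
  .seq (l.compile d) (.seq (.const (d + 1) 0) (.seq (Ex.copy (d + 2) x)
    (.seq
      (.whileNonzero d
        (.seq (Ex.copy x (d + 1)) (.seq (e.compile (d + 3)) (.seq (.store a x (d + 3))
          (.seq (.const (d + 3) 1)
            (.seq (.add (d + 1) (d + 1) (d + 3)) (.sub d d (d + 3))))))))
      (Ex.copy x (d + 2)))))

/-- The loop of `fill`, when the first `i` cells have been written and `m` are left. -/
theorem fill_loop_exec {d a x : ℕ} {e : Ex} {X R : ℕ → Prop} (hx : x < d) (he : e.Below d)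
    (hu : e.Uses R X) (hR : ¬ R a) (s : State) :
    ∀ (m i : ℕ) (u : State),
    u.AgreeOn (fun y => y < d ∧ y ≠ x) (fun _ => True) (s.fill a x i e) → u.var d = m →
    u.var (d + 1) = i →
    ∃ u', Exec (.whileNonzero d
        (.seq (Ex.copy x (d + 1)) (.seq (e.compile (d + 3)) (.seq (.store a x (d + 3))
          (.seq (.const (d + 3) 1)
            (.seq (.add (d + 1) (d + 1) (d + 3)) (.sub d d (d + 3)))))))) u
        (∑ j ∈ Finset.range m, (e.cost (s.setVar x (i + j)) + 7) + 1) u' ∧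
      u'.AgreeOn (fun y => y < d ∧ y ≠ x) (fun _ => True) (s.fill a x (i + m) e) ∧
      u'.var (d + 2) = u.var (d + 2) := by
  intro m
  induction m with
  | zero => exact fun i u hu hm _ => ⟨u, by simpa using Exec.while_done hm, hu, rfl⟩
  | succ m ih =>
    intro i u hua hm hi
    have e1 := exec_copy u (show x ≠ d + 1 by omega)
    rw [hi] at e1
    obtain ⟨v, e2, a2, v2⟩ := (he.mono (show d ≤ d + 3 by omega)).compilesTo (u.setVar x i)
    -- the body does not read the array that is being filled
    have hag : (u.setVar x i).AgreeOn (· < d) (fun b => b ≠ a) (s.setVar x i) := by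
      refine State.AgreeOn.trans (u := (s.fill a x i e).setVar x i)
        ((hua.setVar x i).mono (fun y hy => by tauto) fun _ _ => trivial) ⟨fun y _ => ?_, ?_⟩
      · simp [State.fill]
      · intro b hb
        simp [State.fill, hb]
    have hue : e.Uses (fun b => b ≠ a) (fun y => y < d) :=
      (hu.inter he.uses).mono (fun b hb => fun hba : b = a => hR (hba ▸ hb.1)) fun _ h => h
    rw [Ex.cost_congr hue hag] at e2
    rw [Ex.eval_congr hue hag] at v2
    have e3 := Exec.store v a x (d + 3)
    set v3 := v.setArr a (v.var x) (v.var (d + 3)) with hv3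
    have e4 := Exec.const v3 (d + 3) 1
    set v4 := v3.setVar (d + 3) 1 with hv4
    have e5 := Exec.add v4 (d + 1) (d + 1) (d + 3)
    set v5 := v4.setVar (d + 1) (v4.var (d + 1) + v4.var (d + 3)) with hv5
    have e6 := Exec.sub v5 d d (d + 3)
    set v6 := v5.setVar d (v5.var d - v5.var (d + 3)) with hv6
    have w0 : v.var d = m + 1 := by
      rw [a2.1 d (by omega)]; simp [show d ≠ x by omega, hm]
    have w1 : v.var (d + 1) = i := by
      rw [a2.1 (d + 1) (by omega)]; simp [show d + 1 ≠ x by omega, hi]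
    have w2 : v.var (d + 2) = u.var (d + 2) := by
      rw [a2.1 (d + 2) (by omega)]; simp [show d + 2 ≠ x by omega]
    have wx : v.var x = i := by
      rw [a2.1 x (by omega)]; simp
    have sv : ∀ z, v3.var z = v.var z := fun _ => rfl
    have hv6a : v6.AgreeOn (fun y => y < d ∧ y ≠ x) (fun _ => True) (s.fill a x (i + 1) e) := by
      refine ⟨fun y hy => ?_, fun b _ => ?_⟩
      · have := a2.1 y (by omega)
        simp only [State.setVar_var, hy.2, if_false] at this
        have h1 : y ≠ d := by omega
        have h3 : y ≠ d + 3 := by omega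
        have h4 : y ≠ d + 1 := by omega
        simp only [hv6, hv5, hv4, sv, State.setVar_var, h1, h3, h4, if_false]
        exact this.trans (hua.1 y hy)
      · have hb := (a2.2 b trivial).trans (hua.2 b trivial)
        simp only [hv6, hv5, hv4, State.setVar_arr, hv3, State.setArr, State.fill] at hb ⊢
        by_cases hba : b = a
        · subst hba
          simp only [Function.update_self] at hb ⊢
          funext j
          rw [hb, wx, v2]
          by_cases hj : j = i
          · simp [hj]
          · have : j < i + 1 ↔ j < i := by omega
            simp [Function.update_of_ne hj, this]
        · simpa [hba] using hb
    obtain ⟨u', e7, a7, t7⟩ := ih (i + 1) v6 hv6a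
      (by simp [hv6, hv5, hv4, sv, w0]) (by simp [hv6, hv5, hv4, sv, w1])
    refine ⟨u', ?_, ?_, ?_⟩
    · refine (Exec.while_step (by omega)
        (e1.seq (e2.seq (e3.seq (e4.seq (e5.seq e6))))) e7).cast ?_
      have hsum : ∑ j ∈ Finset.range m, (e.cost (s.setVar x (i + 1 + j)) + 7) =
          ∑ j ∈ Finset.range m, (e.cost (s.setVar x (i + (j + 1))) + 7) :=
        Finset.sum_congr rfl fun j _ => by rw [show i + (j + 1) = i + 1 + j by omega]
      rw [Finset.sum_range_succ' _ m, hsum, add_zero]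
      omega
    · rwa [show i + (m + 1) = i + 1 + m by omega]
    · rw [t7]
      simp [hv6, hv5, hv4, sv, w2]

theorem runsTo_fill {d a x : ℕ} {l e : Ex} {X R : ℕ → Prop} (hx : x < d) (hl : l.Below d)
    (he : e.Below d) (hu : e.Uses R X) (hR : ¬ R a) (s : State) :
    RunsTo d (fill d a x l e) s
      (l.cost s + ∑ j ∈ Finset.range (l.eval s), (e.cost (s.setVar x j) + 7) + 6)
      (s.fill a x (l.eval s) e) := by
  intro u hus
  obtain ⟨v, e1, a1, v1⟩ := hl.compilesTo u
  rw [Ex.eval_congr hl.uses hus] at v1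
  rw [Ex.cost_congr hl.uses hus] at e1
  have e2 := Exec.const v (d + 1) 0
  set v2 := v.setVar (d + 1) 0 with hv2
  have e3 := exec_copy v2 (show d + 2 ≠ x by omega)
  set v3 := v2.setVar (d + 2) (v2.var x) with hv3
  have a3 : v3.AgreeOn (· < d) (fun _ => True) s :=
    (v2.agreeOn_setVar (by omega) _).trans ((v.agreeOn_setVar (by omega) _).trans (a1.trans hus))
  have hs : s.fill a x 0 e = s := by
    ext b
    · rfl
    · simp [State.fill]
  obtain ⟨w, e4, a4, w4⟩ := fill_loop_exec hx he hu hR s (l.eval s) 0 v3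
    (hs.symm ▸ a3.mono (fun y hy => hy.1) fun _ h => h) (by simp [hv3, hv2, v1])
    (by simp [hv3, hv2])
  have e5 := exec_copy w (show x ≠ d + 2 by omega)
  refine ⟨_, le_rfl, _, (e1.seq (e2.seq (e3.seq (e4.seq e5)))).cast ?_, ⟨fun y hy => ?_, ?_⟩⟩
  · simp only [zero_add]; omega
  · by_cases hyx : y = x
    · have := (a1.trans hus).1 x hx
      simp [hyx, w4, hv3, hv2, show x ≠ d + 1 by omega, this, State.fill]
    · simpa [hyx] using a4.1 y ⟨hy, hyx⟩
  · simpa using a4.2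

end RAM

namespace RAM

/-! ### Polynomial bounds -/

theorem eval_mono_nat (q : Polynomial ℕ) {x y : ℕ} (h : x ≤ y) : q.eval x ≤ q.eval y := by
  rw [Polynomial.eval_eq_sum_range, Polynomial.eval_eq_sum_range]
  exact Finset.sum_le_sum fun i _ => Nat.mul_le_mul_left _ (Nat.pow_le_pow_left h i)

/-- Values and running times of an expression are polynomially bounded in the values of its free
variables and arrays. -/
theorem Ex.exists_poly_bound {R : ℕ → Prop} : ∀ {e : Ex} {X : ℕ → Prop}, e.Uses R X →
    ∃ q : Polynomial ℕ, ∀ (s : State) (V : ℕ), (∀ x, X x → s.var x ≤ V) →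
      (∀ a, R a → ∀ i, s.arr a i ≤ V) → e.eval s ≤ q.eval V ∧ e.cost s ≤ q.eval V
  | .var x, X, h => ⟨Polynomial.X + 2, fun s V hX _ => by
      have := hX x h
      simp [eval, cost]; omega⟩
  | .lit c, X, h => ⟨Polynomial.C (c + 1), fun s V _ _ => by simp [eval, cost]⟩
  | .add e f, X, h => by
    obtain ⟨q, hq⟩ := exists_poly_bound h.1
    obtain ⟨q', hq'⟩ := exists_poly_bound h.2
    refine ⟨q + q' + 1, fun s V hX hR => ?_⟩
    have h1 := hq s V hX hR
    have h2 := hq' s V hX hR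
    simp only [eval, cost, Polynomial.eval_add, Polynomial.eval_one]
    omega
  | .sub e f, X, h => by
    obtain ⟨q, hq⟩ := exists_poly_bound h.1
    obtain ⟨q', hq'⟩ := exists_poly_bound h.2
    refine ⟨q + q' + 1, fun s V hX hR => ?_⟩
    have h1 := hq s V hX hR
    have h2 := hq' s V hX hR
    simp only [eval, cost, Polynomial.eval_add, Polynomial.eval_one]
    omega
  | .arr a e, X, h => by
    obtain ⟨q, hq⟩ := exists_poly_bound h.2
    refine ⟨q + Polynomial.X + 1, fun s V hX hR => ?_⟩
    have h1 := hq s V hX hR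
    have h2 := hR a h.1 (e.eval s)
    simp only [eval, cost, Polynomial.eval_add, Polynomial.eval_one, Polynomial.eval_X]
    omega
  | .ite c e f, X, h => by
    obtain ⟨p, hp⟩ := exists_poly_bound h.1
    obtain ⟨q, hq⟩ := exists_poly_bound h.2.1
    obtain ⟨q', hq'⟩ := exists_poly_bound h.2.2
    refine ⟨p + q + q' + 1, fun s V hX hR => ?_⟩
    have h0 := hp s V hX hR
    have h1 := hq s V hX hR
    have h2 := hq' s V hX hR
    simp only [eval, cost, Polynomial.eval_add, Polynomial.eval_one]
    split_ifs <;> omega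
  | .sum x e f, X, h => by
    obtain ⟨q, hq⟩ := exists_poly_bound h.1
    obtain ⟨q', hq'⟩ := exists_poly_bound h.2
    refine ⟨q + q * (q'.comp (Polynomial.X + q) + 7) + 7, fun s V hX hR => ?_⟩
    have h1 := hq s V hX hR
    have h2 : ∀ i ∈ Finset.range (e.eval s), f.eval (s.setVar x i) ≤ q'.eval (V + q.eval V) ∧
        f.cost (s.setVar x i) ≤ q'.eval (V + q.eval V) := by
      intro i hi
      have hi := Finset.mem_range.1 hi
      refine hq' _ _ (fun y hy => ?_) fun a ha j => (hR a ha j).trans (Nat.le_add_right _ _)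
      rw [State.setVar_var]
      split_ifs with hyx
      · omega
      · exact (hX y (hy.resolve_left hyx)).trans (Nat.le_add_right _ _)
    have h3 : ∑ i ∈ Finset.range (e.eval s), (f.cost (s.setVar x i) + 7) ≤
        q.eval V * (q'.eval (V + q.eval V) + 7) := by
      refine (Finset.sum_le_card_nsmul _ _ _ fun i hi =>
        Nat.add_le_add_right (h2 i hi).2 7).trans ?_
      rw [Finset.card_range, smul_eq_mul]
      exact Nat.mul_le_mul_right _ h1.1
    have h4 : ∑ i ∈ Finset.range (e.eval s), f.eval (s.setVar x i) ≤
        q.eval V * (q'.eval (V + q.eval V) + 7) := by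
      refine (Finset.sum_le_card_nsmul _ _ _ fun i hi => (h2 i hi).1.trans
        (Nat.le_add_right _ 7)).trans ?_
      rw [Finset.card_range, smul_eq_mul]
      exact Nat.mul_le_mul_right _ h1.1
    have h5 : (q + q * (q'.comp (Polynomial.X + q) + 7) + 7).eval V =
        q.eval V + q.eval V * (q'.eval (V + q.eval V) + 7) + 7 := by
      simp [Polynomial.eval_comp, Polynomial.eval_ofNat]
    rw [h5]
    simp only [eval, cost]
    omega

namespace Ex

/-! ### Derived expressions -/

/-- A strict upper bound for the names of the variables. -/
def bound : Ex → ℕ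
  | .var x => x + 1
  | .lit _ => 0
  | .add e f => max e.bound f.bound
  | .sub e f => max e.bound f.bound
  | .arr _ e => e.bound
  | .ite e f g => max e.bound (max f.bound g.bound)
  | .sum x e f => max (x + 1) (max e.bound f.bound)

theorem below_of_bound_le {d : ℕ} : ∀ {e : Ex}, e.bound ≤ d → e.Below d
  | .var _, h => h
  | .lit _, _ => trivial
  | .add _ _, h =>
    ⟨below_of_bound_le (le_of_max_le_left h), below_of_bound_le (le_of_max_le_right h)⟩
  | .sub _ _, h =>
    ⟨below_of_bound_le (le_of_max_le_left h), below_of_bound_le (le_of_max_le_right h)⟩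
  | .arr _ e, h => below_of_bound_le (e := e) h
  | .ite e f g, h => by
    simp only [bound, max_le_iff] at h
    exact ⟨below_of_bound_le h.1, below_of_bound_le h.2.1, below_of_bound_le h.2.2⟩
  | .sum x e f, h => by
    simp only [bound, max_le_iff] at h
    exact ⟨h.1, below_of_bound_le h.2.1, below_of_bound_le h.2.2⟩

/-- The product `e * f`, as the sum of `e` copies of `f`. -/
def mul (e f : Ex) : Ex := .sum f.bound e f

@[simp] theorem eval_mul (e f : Ex) (s : State) : (mul e f).eval s = e.eval s * f.eval s := by
  simp [mul, eval, eval_setVar (below_of_bound_le (e := f) le_rfl) le_rfl]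

theorem Uses.mul {e f : Ex} {R X : ℕ → Prop} (he : e.Uses R X) (hf : f.Uses R X) :
    (mul e f).Uses R X :=
  ⟨he, hf.mono (fun _ h => h) fun _ h => Or.inr h⟩

/-- The indicator of `e ≤ f`. -/
def le (e f : Ex) : Ex := .ite (.sub e f) (.lit 1) (.lit 0)

@[simp] theorem eval_le (e f : Ex) (s : State) :
    (le e f).eval s = if e.eval s ≤ f.eval s then 1 else 0 := by
  simp [le, eval, Nat.sub_eq_zero_iff_le]

/-- The indicator of `e = f`. -/
def eq (e f : Ex) : Ex := .ite (.add (.sub e f) (.sub f e)) (.lit 1) (.lit 0)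

@[simp] theorem eval_eq (e f : Ex) (s : State) :
    (eq e f).eval s = if e.eval s = f.eval s then 1 else 0 := by
  have : e.eval s - f.eval s + (f.eval s - e.eval s) = 0 ↔ e.eval s = f.eval s := by omega
  simp only [eq, eval, this]

/-- The quotient `⌊e / f⌋`, as the number of `i < e` with `(i + 1) * f ≤ e`. -/
def div (e f : Ex) : Ex :=
  .sum (max e.bound f.bound) e (le (mul (.add (.var (max e.bound f.bound)) (.lit 1)) f) e)

theorem eval_div (e f : Ex) (s : State) (hf : 0 < f.eval s) :
    (div e f).eval s = e.eval s / f.eval s := by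
  have h1 : ∀ i, e.eval (s.setVar (max e.bound f.bound) i) = e.eval s := fun i =>
    eval_setVar (below_of_bound_le (e := e) le_rfl) (le_max_left _ _) s i
  have h2 : ∀ i, f.eval (s.setVar (max e.bound f.bound) i) = f.eval s := fun i =>
    eval_setVar (below_of_bound_le (e := f) le_rfl) (le_max_right _ _) s i
  simp only [div, eval, eval_le, eval_mul, State.setVar_var, h1, h2, if_true]
  rw [← Finset.sum_filter, ← Finset.card_eq_sum_ones]
  have : (Finset.range (e.eval s)).filter (fun i => (i + 1) * f.eval s ≤ e.eval s) =
      Finset.range (e.eval s / f.eval s) := by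
    ext i
    rw [Finset.mem_filter, Finset.mem_range, Finset.mem_range, ← Nat.le_div_iff_mul_le hf]
    have := Nat.div_le_self (e.eval s) (f.eval s)
    omega
  rw [this, Finset.card_range]

theorem Uses.le {e f : Ex} {R X : ℕ → Prop} (he : e.Uses R X) (hf : f.Uses R X) :
    (le e f).Uses R X :=
  ⟨⟨he, hf⟩, trivial, trivial⟩

theorem Uses.eq {e f : Ex} {R X : ℕ → Prop} (he : e.Uses R X) (hf : f.Uses R X) :
    (eq e f).Uses R X :=
  ⟨⟨⟨he, hf⟩, hf, he⟩, trivial, trivial⟩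

theorem Uses.div {e f : Ex} {R X : ℕ → Prop} (he : e.Uses R X) (hf : f.Uses R X) :
    (div e f).Uses R X :=
  ⟨he, .le (.mul ⟨.inl rfl, trivial⟩ (hf.mono (fun _ h => h) fun _ => .inr))
    (he.mono (fun _ h => h) fun _ => .inr)⟩

end Ex

end RAM

/-! ### The certificate-selection instance of a hypergraph -/

/-- The instance with certificates `0, …, M` and out-class datapoints `0, …, N - 1`, in which
`y` and the certificate `φ < M` are adjacent when `T φ y`, and the certificate `M` has no out-class
neighbour. There are `M + (M - 2 * P)` in-class datapoints; the datapoint `x` has the single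
neighbour `min x M`. If `2 * P ≤ M`, completeness `1 / 2` thus forces a verifier to accept at least
`P` of the certificates below `M`, and this is enough if it accepts the certificate `M`. The
constant `1 / 2` does not depend on `P`, so that no fraction has to be reduced to write down the
encoding. -/
def gapInstance (N M P : ℕ) (hN : 0 < N) (hM : 0 < M) (T : ℕ → ℕ → Prop) : DCS2Instance where
  nIn := M + (M - 2 * P)
  m := M + 1
  nOut := N
  nIn_pos := by omega
  nOut_pos := hN
  G := { inAdj := fun x φ => φ.val = min x.val M
         outAdj := fun y φ => φ.val < M ∧ T φ.val y.val }
  εc := 1 / 2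
  εs := 1
  q := 0
  εc_nonneg := by norm_num
  εs_nonneg := by norm_num
  q_nonneg := le_rfl
  isEpsCSI := by
    refine ⟨fun x => ⟨min x.val M, by omega⟩, fun _ => true, fun x => rfl, ?_, ?_⟩
    · have : (M + (M - 2 * P) : ℕ) ≠ 0 := by omega
      have h : ((M + (M - 2 * P) : ℕ) : ℚ) ≠ 0 := by exact_mod_cast this
      rw [CSI.completeness]
      simp only [Finset.filter_true, Finset.card_univ, Fintype.card_fin]
      rw [div_self h]
      norm_num
    · rw [sub_self]
      exact div_nonneg (Nat.cast_nonneg _) (Nat.cast_nonneg _)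

/-- The certificates below `M` accepted by a verifier of `gapInstance`. -/
def accepted {M : ℕ} (A : Fin (M + 1) → Bool) : Finset ℕ :=
  (Finset.range M).filter fun φ => ∃ h : φ < M + 1, A ⟨φ, h⟩ = true

/-- The elements of `{0, …, N - 1}` related to a member of `F`. -/
def covered (N : ℕ) (T : ℕ → ℕ → Prop) (F : Finset ℕ) : Finset ℕ :=
  open Classical in (Finset.range N).filter fun y => ∃ φ ∈ F, T φ y

section gapInstance

variable {N M P : ℕ} {hN : 0 < N} {hM : 0 < M} {T : ℕ → ℕ → Prop}

theorem card_filter_min (A : Fin (M + 1) → Bool) (E : ℕ) (f : Fin (M + E) → Fin (M + 1))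
    (hf : ∀ x, (f x).val = min x.val M) :
    (Finset.univ.filter fun x : Fin (M + E) => A (f x) = true).card =
      (accepted A).card + if A (Fin.last M) = true then E else 0 := by
  rw [Finset.card_filter, Fin.sum_univ_add]
  congr 1
  · rw [accepted, Finset.card_filter, Finset.sum_range]
    refine Finset.sum_congr rfl fun i _ => ?_
    have : f (Fin.castAdd E i) = ⟨i.val, by omega⟩ := Fin.ext (by rw [hf]; simp)
    rw [this]
    congr 1
    simp [show i.val < M + 1 by omega]
  · have : ∀ i : Fin E, f (Fin.natAdd M i) = Fin.last M := fun i =>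
      Fin.ext (by rw [hf]; simp)
    simp only [this]
    split_ifs <;> simp

theorem CSI.avgPrecision_le_one {n m n' : ℕ} (G : CSI (Fin n) (Fin m) (Fin n'))
    (f : Fin n → Fin m) : G.avgPrecision f ≤ 1 := by
  refine div_le_one_of_le₀ ?_ (Nat.cast_nonneg _)
  refine (Finset.sum_le_card_nsmul _ _ 1 fun x _ => ?_).trans (by simp)
  exact div_le_one_of_le₀ (le_add_of_nonneg_right (Nat.cast_nonneg _)) (by positivity)

/-- The prover has no choice, so feasibility only depends on the number of accepted edges and on
whether the last certificate is accepted. -/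
theorem gapInstance_feasible_iff (A : Fin (M + 1) → Bool) :
    (gapInstance N M P hN hM T).Feasible A ↔
      M + (M - 2 * P) ≤
        2 * ((accepted A).card + if A (Fin.last M) = true then M - 2 * P else 0) := by
  have hpos : (0 : ℚ) < ((M + (M - 2 * P) : ℕ) : ℚ) := by
    exact_mod_cast (show 0 < M + (M - 2 * P) by omega)
  have key : ∀ f : Fin (M + (M - 2 * P)) → Fin (M + 1), (∀ x, (f x).val = min x.val M) →
      (1 - 1 / 2 ≤ CSI.completeness A f ↔ M + (M - 2 * P) ≤
        2 * ((accepted A).card + if A (Fin.last M) = true then M - 2 * P else 0)) := by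
    intro f hf
    rw [CSI.completeness, card_filter_min A _ f hf, Fintype.card_fin, le_div_iff₀ hpos,
      ← @Nat.cast_le ℚ, Nat.cast_mul]
    constructor <;> intro h <;> push_cast at h ⊢ <;> linarith
  constructor
  · rintro ⟨f, hf, hc, -⟩
    exact (key f hf).1 hc
  · intro h
    refine ⟨fun x => (⟨min x.val M, by omega⟩ : Fin (M + 1)), fun x => rfl,
      (key _ fun _ => rfl).2 h, ?_⟩
    exact (CSI.avgPrecision_le_one _ _).trans (by norm_num [gapInstance])

theorem gapInstance_feasible_true :
    (gapInstance N M P hN hM T).Feasible fun _ : Fin (M + 1) => true := by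
  refine (gapInstance_feasible_iff fun _ => true).2 ?_
  have : accepted (M := M) (fun _ => true) = Finset.range M := by
    ext φ; simp [accepted]; omega
  rw [this]
  simp
  omega

theorem le_card_accepted_of_feasible (hP : 2 * P ≤ M) {A : Fin (M + 1) → Bool}
    (h : (gapInstance N M P hN hM T).Feasible A) : P ≤ (accepted A).card := by
  have := (gapInstance_feasible_iff A).1 h
  split_ifs at this <;> omega

theorem gapInstance_feasible_of_le (hP : 2 * P ≤ M) {A : Fin (M + 1) → Bool}
    (hA : P ≤ (accepted A).card) (hlast : A (Fin.last M) = true) :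
    (gapInstance N M P hN hM T).Feasible A := by
  rw [gapInstance_feasible_iff, if_pos hlast]
  omega

theorem one_sub_soundness_gapInstance (A : Fin (M + 1) → Bool) :
    1 - ((gapInstance N M P hN hM T).G.soundness A : ℝ) =
      ((covered N T (accepted A)).card : ℝ) / N := by
  classical
  have hN' : (N : ℝ) ≠ 0 := by exact_mod_cast hN.ne'
  have h1 : ∀ inst : DecidablePred fun y : Fin N => ∀ φ,
      (gapInstance N M P hN hM T).G.outAdj y φ → A φ = false,
      (Finset.univ.filter fun y : Fin N =>
        ∀ φ, (gapInstance N M P hN hM T).G.outAdj y φ → A φ = false).card +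
      (covered N T (accepted A)).card = N := by
    intro inst
    have h2 : (covered N T (accepted A)).card = (Finset.univ.filter fun y : Fin N =>
        ¬ ∀ φ, (gapInstance N M P hN hM T).G.outAdj y φ → A φ = false).card := by
      rw [covered, Finset.card_filter, Finset.card_filter, Finset.sum_range]
      refine Finset.sum_congr rfl fun y _ => ?_
      have hiff : (∃ φ ∈ accepted A, T φ y) ↔
          ¬ ∀ φ, (gapInstance N M P hN hM T).G.outAdj y φ → A φ = false := by
        push Not
        constructor
        · rintro ⟨φ, hφ, hT⟩
          obtain ⟨hφM, hφ', hA⟩ := Finset.mem_filter.1 hφ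
          exact ⟨⟨φ, hφ'⟩, ⟨Finset.mem_range.1 hφM, hT⟩,
            ne_of_eq_of_ne hA (by decide)⟩
        · rintro ⟨φ, ⟨hφ, hT⟩, hA⟩
          exact ⟨φ.val, Finset.mem_filter.2 ⟨Finset.mem_range.2 hφ, φ.2,
            eq_true_of_ne_false hA⟩, hT⟩
      by_cases h : ∃ φ ∈ accepted A, T φ y
      · rw [if_pos h, if_pos (hiff.1 h)]
      · rw [if_neg h, if_neg (mt hiff.2 h)]
    rw [h2]
    convert Finset.card_filter_add_card_filter_not (s := (Finset.univ : Finset (Fin N)))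
      fun y => ∀ φ, (gapInstance N M P hN hM T).G.outAdj y φ → A φ = false
    simp
  unfold CSI.soundness
  rw [eq_div_iff hN', sub_mul]
  push_cast
  rw [show ((Fintype.card (Fin (gapInstance N M P hN hM T).nOut) : ℕ) : ℝ) = N by
    rw [Fintype.card_fin]; rfl, div_mul_cancel₀ _ hN', one_mul]
  rw [sub_eq_iff_eq_add, ← Nat.cast_add, Nat.cast_inj, add_comm]
  exact (h1 _).symm

end gapInstance

/-- An entry of the concatenation of words of the same length. -/
theorem List.getD_flatten_of_length_eq {α : Type*} (d : α) {b : ℕ} :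
    ∀ (L : List (List α)), (∀ l ∈ L, l.length = b) → ∀ i j, j < b → i < L.length →
      L.flatten.getD (i * b + j) d = (L.getD i []).getD j d
  | [], _, i, j, _, hi => by simp at hi
  | l :: L, hL, i, j, hj, hi => by
    have hl := hL l (by simp)
    rw [List.flatten_cons]
    cases i with
    | zero => rw [List.getD_append _ _ _ _ (by omega)]; simp
    | succ i =>
      rw [List.getD_append_right _ _ _ _ (by rw [hl]; nlinarith)]
      rw [show (i + 1) * b + j - l.length = i * b + j by rw [hl, Nat.add_mul]; omega]
      rw [List.getD_flatten_of_length_eq d L (fun l hl => hL l (by simp [hl])) i j hj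
        (by simpa using hi)]
      simp

theorem List.length_flatten_of_length_eq {α : Type*} {b : ℕ} (L : List (List α))
    (hL : ∀ l ∈ L, l.length = b) : L.flatten.length = L.length * b := by
  rw [List.length_flatten, List.map_eq_replicate_iff.2 hL, List.sum_replicate, smul_eq_mul]

/-- The cells of the word that encodes `gapInstance`. -/
def gapWord (N M P : ℕ) (T : ℕ → ℕ → Prop) (j : ℕ) : ℕ :=
  open Classical in
  if j < 9 then [M + (M - 2 * P), M + 1, N, 1, 2, 1, 1, 0, 1].getD j 0
  else if j - 9 < (M + (M - 2 * P)) * (M + 1) then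
    if (j - 9) % (M + 1) = min ((j - 9) / (M + 1)) M then 1 else 0
  else if j - 9 - (M + (M - 2 * P)) * (M + 1) < N * (M + 1) then
    if (j - 9 - (M + (M - 2 * P)) * (M + 1)) % (M + 1) < M ∧
      T ((j - 9 - (M + (M - 2 * P)) * (M + 1)) % (M + 1))
        ((j - 9 - (M + (M - 2 * P)) * (M + 1)) / (M + 1)) then 1 else 0
  else 0

theorem getD_flatten_ofFn (a b : ℕ) (hb : 0 < b) (F : ℕ → ℕ → ℕ) (j : ℕ) :
    (List.ofFn fun x : Fin a => List.ofFn fun φ : Fin b => F x φ).flatten.getD j 0 =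
      if j < a * b then F (j / b) (j % b) else 0 := by
  have hl : ∀ l ∈ List.ofFn fun x : Fin a => List.ofFn fun φ : Fin b => F x φ, l.length = b := by
    intro l hl
    obtain ⟨x, rfl⟩ := (List.mem_ofFn' _ _).1 hl
    simp
  split_ifs with hj
  · have hq : j / b < a := (Nat.div_lt_iff_lt_mul hb).2 hj
    have hm := Nat.mod_lt j hb
    conv_lhs => rw [← Nat.div_add_mod' j b]
    rw [List.getD_flatten_of_length_eq 0 _ hl _ _ hm (by simpa using hq)]
    simp [List.getD_eq_getElem?_getD, hq, hm]
  · refine List.getD_eq_default _ _ ?_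
    rw [List.length_flatten_of_length_eq _ hl, List.length_ofFn]
    omega

theorem length_encode_gapInstance (N M P : ℕ) (hN : 0 < N) (hM : 0 < M) (T : ℕ → ℕ → Prop) :
    (gapInstance N M P hN hM T).encode.length =
      9 + (M + (M - 2 * P)) * (M + 1) + N * (M + 1) := by
  simp only [DCS2Instance.encode, List.length_append]
  rw [List.length_flatten_of_length_eq (b := M + 1), List.length_flatten_of_length_eq (b := M + 1)]
  · simp [gapInstance]
  · intro l hl
    obtain ⟨x, rfl⟩ := (List.mem_ofFn' _ _).1 hl
    simp [gapInstance]
  · intro l hl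
    obtain ⟨x, rfl⟩ := (List.mem_ofFn' _ _).1 hl
    simp [gapInstance]

theorem getD_encode_gapInstance (N M P : ℕ) (hN : 0 < N) (hM : 0 < M) (T : ℕ → ℕ → Prop) (j : ℕ) :
    (gapInstance N M P hN hM T).encode.getD j 0 = gapWord N M P T j := by
  classical
  have hhead : [(gapInstance N M P hN hM T).nIn, (gapInstance N M P hN hM T).m,
      (gapInstance N M P hN hM T).nOut, (gapInstance N M P hN hM T).εc.num.toNat,
      (gapInstance N M P hN hM T).εc.den, (gapInstance N M P hN hM T).εs.num.toNat,
      (gapInstance N M P hN hM T).εs.den, (gapInstance N M P hN hM T).q.num.toNat,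
      (gapInstance N M P hN hM T).q.den] = [M + (M - 2 * P), M + 1, N, 1, 2, 1, 1, 0, 1] := by
    norm_num [gapInstance]
  have hl1 := getD_flatten_ofFn (M + (M - 2 * P)) (M + 1) (by omega)
    (fun x φ => @ite ℕ (φ = min x M) (Classical.propDecidable _) 1 0)
  have hl2 := getD_flatten_ofFn N (M + 1) (by omega)
    (fun y φ => @ite ℕ (φ < M ∧ T φ y) (Classical.propDecidable _) 1 0)
  have hlen : (List.ofFn fun x : Fin (M + (M - 2 * P)) => List.ofFn fun φ : Fin (M + 1) =>
      @ite ℕ (φ.val = min x.val M) (Classical.propDecidable _) 1 0).flatten.length =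
      (M + (M - 2 * P)) * (M + 1) := by
    rw [List.length_flatten_of_length_eq (b := M + 1)]
    · simp
    · intro l hl
      obtain ⟨x, rfl⟩ := (List.mem_ofFn' _ _).1 hl
      simp
  have henc : (gapInstance N M P hN hM T).encode =
      [M + (M - 2 * P), M + 1, N, 1, 2, 1, 1, 0, 1] ++
      ((List.ofFn fun x : Fin (M + (M - 2 * P)) => List.ofFn fun φ : Fin (M + 1) =>
        @ite ℕ (φ.val = min x.val M) (Classical.propDecidable _) 1 0).flatten ++
      (List.ofFn fun y : Fin N => List.ofFn fun φ : Fin (M + 1) =>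
        @ite ℕ (φ.val < M ∧ T φ.val y.val) (Classical.propDecidable _) 1 0).flatten) := by
    rw [DCS2Instance.encode, hhead, List.append_assoc]
    rfl
  rw [henc, gapWord]
  by_cases h1 : j < 9
  · rw [if_pos h1, List.getD_append _ _ _ _ h1]
  · rw [if_neg h1, List.getD_append_right _ _ _ _ (not_lt.1 h1)]
    by_cases h2 : j - 9 < (M + (M - 2 * P)) * (M + 1)
    · rw [if_pos h2, List.getD_append _ _ _ _ (by rw [hlen]; exact h2)]
      exact (hl1 (j - 9)).trans ((if_pos h2).trans (by congr))
    · rw [if_neg h2, List.getD_append_right _ _ _ _ (by rw [hlen]; exact not_lt.1 h2), hlen]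
      exact (hl2 _).trans (by congr)

/-! ### Edges of a hypergraph as certificates -/

namespace UniformHypergraph

variable {r n : ℕ} (H : UniformHypergraph r n)

theorem mem_edgeList {l : List (Fin n)} :
    l ∈ H.edgeList ↔ (l.Sublist (List.finRange n) ∧ l.length = r) ∧ ∃ e ∈ H, e.1 = l.toFinset := by
  simp [edgeList, List.mem_sublistsLen]

/-- A sublist of the increasing list of all vertices is determined by its set of entries. -/
theorem sublist_finRange_injOn {l l' : List (Fin n)} (h : l.Sublist (List.finRange n))
    (h' : l'.Sublist (List.finRange n)) (e : l.toFinset = l'.toFinset) : l = l' := by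
  have hs := (List.sortedLT_finRange n).pairwise
  refine List.Perm.eq_of_pairwise (le := (· < ·))
    (fun a b _ _ h1 h2 => absurd h1 (not_lt.2 h2.le)) (hs.sublist h) (hs.sublist h') ?_
  rw [List.perm_ext_iff_of_nodup ((List.nodup_finRange n).sublist h)
    ((List.nodup_finRange n).sublist h')]
  intro a
  rw [← List.mem_toFinset, e, List.mem_toFinset]

theorem nodup_map_edgeList : (H.edgeList.map List.toFinset).Nodup := by
  refine (List.nodup_map_iff_inj_on ?_).2 fun l hl l' hl' e =>
    sublist_finRange_injOn (H.mem_edgeList.1 hl).1.1 (H.mem_edgeList.1 hl').1.1 e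
  exact (List.nodup_sublistsLen _ (List.nodup_finRange n)).filter _

theorem toFinset_map_edgeList :
    (H.edgeList.map List.toFinset).toFinset = H.image Subtype.val := by
  ext e
  simp only [List.mem_toFinset, List.mem_map, Finset.mem_image]
  constructor
  · rintro ⟨l, hl, rfl⟩
    exact (H.mem_edgeList.1 hl).2
  · rintro ⟨e, he, rfl⟩
    have hl : ((List.finRange n).filter (· ∈ e.1)).toFinset = e.1 := by ext; simp
    refine ⟨_, H.mem_edgeList.2 ⟨⟨List.filter_sublist, ?_⟩, e, he, hl.symm⟩, hl⟩
    rw [← List.toFinset_card_of_nodup ((List.nodup_finRange n).filter _), hl, e.2]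

theorem length_edgeList : H.edgeList.length = H.card := by
  have := List.toFinset_card_of_nodup H.nodup_map_edgeList
  rw [toFinset_map_edgeList, Finset.card_image_of_injective _ Subtype.val_injective,
    List.length_map] at this
  exact this.symm

/-- The edge of index `φ` in the canonical order. -/
def edgeAt (φ : ℕ) : Finset (Fin n) := (H.edgeList.getD φ []).toFinset

theorem edgeAt_eq_getElem {φ : ℕ} (h : φ < H.card) :
    H.edgeAt φ = (H.edgeList.map List.toFinset)[φ]'(by simpa [length_edgeList] using h) := by
  have h' : φ < H.edgeList.length := by rwa [length_edgeList]
  simp [edgeAt, List.getD_eq_getElem?_getD, h']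

theorem injOn_edgeAt : Set.InjOn H.edgeAt (Finset.range H.card) := by
  intro φ hφ ψ hψ h
  have hφ' := Finset.mem_range.1 (Finset.mem_coe.1 hφ)
  have hψ' := Finset.mem_range.1 (Finset.mem_coe.1 hψ)
  rw [edgeAt_eq_getElem H hφ', edgeAt_eq_getElem H hψ'] at h
  exact (H.nodup_map_edgeList.getElem_inj_iff).1 h

theorem image_edgeAt : (Finset.range H.card).image H.edgeAt = H.image Subtype.val := by
  rw [← toFinset_map_edgeList]
  ext e
  simp only [Finset.mem_image, Finset.mem_range, List.mem_toFinset]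
  constructor
  · rintro ⟨φ, hφ, rfl⟩
    rw [edgeAt_eq_getElem H hφ]
    exact List.getElem_mem _
  · intro he
    obtain ⟨φ, hφ, rfl⟩ := List.mem_iff_getElem.1 he
    have hφ' : φ < H.card := by simpa [length_edgeList] using hφ
    exact ⟨φ, hφ', edgeAt_eq_getElem H hφ'⟩

/-- The edges inside a set of vertices. -/
def edgesIn (U : Finset (Fin n)) : UniformHypergraph r n := H.filter fun e => e.1 ⊆ U

theorem card_edgesIn (U : Finset (Fin n)) :
    (H.edgesIn U).card = ((Finset.range H.card).filter fun φ => H.edgeAt φ ⊆ U).card := by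
  have hval := Finset.card_image_of_injective (H.edgesIn U) Subtype.val_injective
  rw [← hval, ← Finset.card_image_of_injOn (s := (Finset.range H.card).filter _) (f := H.edgeAt)
      (H.injOn_edgeAt.mono (Finset.coe_subset.2 (Finset.filter_subset _ _)))]
  congr 1
  have h := Finset.ext_iff.1 H.image_edgeAt
  simp only [Finset.mem_image, Finset.mem_range] at h
  ext e
  simp only [edgesIn, Finset.mem_image, Finset.mem_filter, Finset.mem_range]
  constructor
  · rintro ⟨e, ⟨he, hU⟩, rfl⟩
    obtain ⟨φ, hφ, hφe⟩ := (h e.1).2 ⟨e, he, rfl⟩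
    exact ⟨φ, ⟨hφ, hφe ▸ hU⟩, hφe⟩
  · rintro ⟨φ, ⟨hφ, hU⟩, rfl⟩
    obtain ⟨e, he, hφe⟩ := (h _).1 ⟨φ, hφ, rfl⟩
    exact ⟨e, ⟨he, hφe ▸ hU⟩, hφe⟩

/-- The degrees in an induced subhypergraph sum up to `r` times the number of its edges. -/
theorem avgDegree_eq (U : Finset (Fin n)) :
    H.avgDegree U = (r * (H.edgesIn U).card : ℕ) / (U.card : ℝ) := by
  have : ∑ v ∈ U, (H.filter fun e => v ∈ e.1 ∧ e.1 ⊆ U).card = r * (H.edgesIn U).card := by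
    have h1 : ∀ v, (H.filter fun e => v ∈ e.1 ∧ e.1 ⊆ U) =
        (H.edgesIn U).filter fun e => v ∈ e.1 := by
      intro v
      ext e
      simp only [edgesIn, Finset.mem_filter]
      tauto
    simp only [h1, Finset.card_filter]
    rw [Finset.sum_comm, mul_comm, ← smul_eq_mul, ← Finset.sum_const]
    refine Finset.sum_congr rfl fun e he => ?_
    rw [← Finset.card_filter]
    refine Eq.trans (congrArg Finset.card ?_) e.2
    ext v
    have := (Finset.mem_filter.1 he).2
    simp only [Finset.mem_filter]
    exact ⟨fun h => h.2, fun h => ⟨this h, h⟩⟩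
  rw [avgDegree, this]

end UniformHypergraph

namespace DenseVsRandomInput

variable {r : ℕ} (I : DenseVsRandomInput r)

/-- The cells of the input word. -/
def cell (j : ℕ) : ℕ := I.encode.getD j 0

/-- The vertex `y` occurs in the edge of index `φ` of the hypergraph stored in the word `B`. -/
def Incident (r : ℕ) (B : ℕ → ℕ) (φ y : ℕ) : Prop := ∃ j < r, B (3 + φ * r + j) = y

theorem cell_zero : I.cell 0 = I.n := rfl

theorem cell_one : I.cell 1 = I.k := rfl

theorem cell_two : I.cell 2 = I.H.card := rfl

theorem length_of_mem_edges {l : List ℕ} (hl : l ∈ I.H.edgeList.map fun l => l.map Fin.val) :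
    l.length = r := by
  obtain ⟨l', hl', rfl⟩ := List.mem_map.1 hl
  simpa using (I.H.mem_edgeList.1 hl').1.2

theorem length_encode : I.encode.length = 3 + I.H.card * r := by
  rw [encode, List.length_append, List.length_flatten_of_length_eq _ fun l => I.length_of_mem_edges,
    List.length_map, I.H.length_edgeList]
  rfl

theorem incident_iff {φ y : ℕ} (hφ : φ < I.H.card) :
    Incident r I.cell φ y ↔ ∃ v ∈ I.H.edgeAt φ, v.val = y := by
  have hφ' : φ < I.H.edgeList.length := by rwa [I.H.length_edgeList]
  have hlen : (I.H.edgeList[φ]).length = r := (I.H.mem_edgeList.1 (List.getElem_mem hφ')).1.2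
  have h1 : ∀ (j : ℕ) (hj : j < r),
      I.cell (3 + φ * r + j) = (I.H.edgeList[φ][j]'(hj.trans_eq hlen.symm)).val := by
    intro j hj
    rw [cell, encode, List.getD_append_right _ _ _ _ (by simp; omega)]
    rw [show 3 + φ * r + j - [I.n, I.k, I.H.card].length = φ * r + j by simp; omega,
      List.getD_flatten_of_length_eq 0 _ (fun l => I.length_of_mem_edges) _ _ hj
        (by simpa using hφ')]
    simp [List.getD_eq_getElem?_getD, hφ', hlen, hj]
  have h2 : I.H.edgeAt φ = (I.H.edgeList[φ]).toFinset := by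
    simp [UniformHypergraph.edgeAt, List.getD_eq_getElem?_getD, hφ']
  rw [h2]
  constructor
  · rintro ⟨j, hj, rfl⟩
    exact ⟨_, List.mem_toFinset.2 (List.getElem_mem (hj.trans_eq hlen.symm)), (h1 j hj).symm⟩
  · rintro ⟨v, hv, rfl⟩
    obtain ⟨j, hj, rfl⟩ := List.mem_iff_getElem.1 (List.mem_toFinset.1 hv)
    exact ⟨j, hlen ▸ hj, h1 j (hj.trans_eq hlen)⟩

theorem cell_le {V : ℕ} (hn : I.n ≤ V) (hk : I.k ≤ V) (hm : I.H.card ≤ V) (j : ℕ) :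
    I.cell j ≤ V := by
  rw [cell, List.getD_eq_getElem?_getD]
  by_cases hj : j < I.encode.length
  · have hmem : I.encode[j] ∈ I.encode := List.getElem_mem hj
    rw [List.getElem?_eq_getElem hj, Option.getD_some]
    simp only [encode, List.mem_append, List.mem_cons, List.mem_flatten, List.mem_map] at hmem
    rcases hmem with (h | h | h | h) | ⟨_, ⟨l, hl, rfl⟩, h⟩
    · exact h.trans_le hn
    · exact h.trans_le hk
    · exact h.trans_le hm
    · simp at h
    · obtain ⟨v, -, hv⟩ := List.mem_map.1 h
      exact hv.symm.trans_le (v.2.le.trans hn)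
  · rw [List.getElem?_eq_none (not_lt.1 hj)]
    exact Nat.zero_le _

/-- A set of edges lies inside the set of vertices that it covers. -/
theorem card_le_edgesIn (F : Finset ℕ) (hF : F ⊆ Finset.range I.H.card) :
    ∃ U : Finset (Fin I.n), U.card = (covered I.n (Incident r I.cell) F).card ∧
      F.card ≤ (I.H.edgesIn U).card := by
  classical
  refine ⟨F.biUnion I.H.edgeAt, ?_, ?_⟩
  · rw [← Finset.card_map Fin.valEmbedding]
    congr 1
    ext y
    simp only [covered, Finset.mem_map, Finset.mem_biUnion, Finset.mem_filter, Finset.mem_range,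
      Fin.valEmbedding_apply]
    constructor
    · rintro ⟨v, ⟨φ, hφ, hv⟩, rfl⟩
      exact ⟨v.2, φ, hφ, (I.incident_iff (Finset.mem_range.1 (hF hφ))).2 ⟨v, hv, rfl⟩⟩
    · rintro ⟨-, φ, hφ, h⟩
      obtain ⟨v, hv, rfl⟩ := (I.incident_iff (Finset.mem_range.1 (hF hφ))).1 h
      exact ⟨v, ⟨φ, hφ, hv⟩, rfl⟩
  · rw [I.H.card_edgesIn]
    refine Finset.card_le_card fun φ hφ => Finset.mem_filter.2 ⟨hF hφ, ?_⟩
    exact Finset.subset_biUnion_of_mem I.H.edgeAt hφ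

theorem card_covered_le (S : Finset (Fin I.n)) :
    (covered I.n (Incident r I.cell)
      ((Finset.range I.H.card).filter fun φ => I.H.edgeAt φ ⊆ S)).card ≤ S.card := by
  classical
  rw [← Finset.card_map Fin.valEmbedding (s := S)]
  refine Finset.card_le_card fun y hy => ?_
  rw [covered, Finset.mem_filter] at hy
  obtain ⟨-, φ, hφ, h⟩ := hy
  obtain ⟨hφ, hS⟩ := Finset.mem_filter.1 hφ
  obtain ⟨v, hv, rfl⟩ := (I.incident_iff (Finset.mem_range.1 hφ)).1 h
  exact Finset.mem_map.2 ⟨v, hS hv, rfl⟩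

end DenseVsRandomInput

/-! ### The random hypergraph -/

namespace UniformHypergraph

variable {r n : ℕ} {ρ : ℝ}

/-- The probability of a single hypergraph. -/
def weight (ρ : ℝ) (H : UniformHypergraph r n) : ℝ :=
  ρ ^ H.card * (1 - ρ) ^ (n.choose r - H.card)

theorem weight_nonneg (h0 : 0 ≤ ρ) (h1 : ρ ≤ 1) (H : UniformHypergraph r n) : 0 ≤ weight ρ H :=
  mul_nonneg (pow_nonneg h0 _) (pow_nonneg (sub_nonneg.2 h1) _)

theorem card_edges (r n : ℕ) :
    (Finset.univ : Finset {e : Finset (Fin n) // e.card = r}).card = n.choose r := by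
  rw [Finset.card_univ, Fintype.card_finset_len, Fintype.card_fin]

/-- The generating function of the number of edges in the set `F` of possible edges. -/
theorem sum_weight_mul_pow (ρ x : ℝ) (F : Finset {e : Finset (Fin n) // e.card = r}) :
    ∑ H : UniformHypergraph r n, weight ρ H * x ^ (H ∩ F).card =
      (1 + (x - 1) * ρ) ^ F.card := by
  classical
  have h := Finset.prod_add (fun e => ρ * if e ∈ F then x else 1) (fun _ => 1 - ρ)
    (Finset.univ : Finset {e : Finset (Fin n) // e.card = r})
  rw [Finset.powerset_univ] at h
  have h1 : ∏ e : {e : Finset (Fin n) // e.card = r}, ((ρ * if e ∈ F then x else 1) + (1 - ρ)) =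
      (1 + (x - 1) * ρ) ^ F.card := by
    have : ∀ e : {e : Finset (Fin n) // e.card = r}, ((ρ * if e ∈ F then x else 1) + (1 - ρ)) =
        if e ∈ F then 1 + (x - 1) * ρ else 1 := by
      intro e; split_ifs <;> ring
    simp only [this, Finset.prod_ite_mem, Finset.univ_inter, Finset.prod_const]
  rw [← h1, h]
  refine Finset.sum_congr rfl fun H _ => ?_
  rw [Finset.prod_mul_distrib, Finset.prod_const, Finset.prod_ite_mem, Finset.prod_const,
    Finset.prod_const, Finset.card_sdiff_of_subset (Finset.subset_univ H), card_edges, weight]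
  ring

theorem randomProb_eq_sum (ρ : ℝ) (P : UniformHypergraph r n → Prop) [DecidablePred P] :
    randomProb r n ρ P = ∑ H : UniformHypergraph r n, if P H then weight ρ H else 0 := by
  simp only [randomProb, weight]
  congr!

theorem randomProb_le_sum (h0 : 0 ≤ ρ) (h1 : ρ ≤ 1) {P : UniformHypergraph r n → Prop}
    {f : UniformHypergraph r n → ℝ} (hf : ∀ H, 0 ≤ f H) (hP : ∀ H, P H → 1 ≤ f H) :
    randomProb r n ρ P ≤ ∑ H, weight ρ H * f H := by
  classical
  rw [randomProb_eq_sum]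
  refine Finset.sum_le_sum fun H _ => ?_
  have hw := weight_nonneg h0 h1 H
  split_ifs with h
  · exact le_mul_of_one_le_right hw (hP H h)
  · exact mul_nonneg hw (hf H)

theorem randomProb_mono (h0 : 0 ≤ ρ) (h1 : ρ ≤ 1) {P Q : UniformHypergraph r n → Prop}
    (h : ∀ H, P H → Q H) : randomProb r n ρ P ≤ randomProb r n ρ Q := by
  classical
  rw [randomProb_eq_sum, randomProb_eq_sum]
  refine Finset.sum_le_sum fun H _ => ?_
  have hw := weight_nonneg h0 h1 H
  by_cases hP : P H
  · rw [if_pos hP, if_pos (h H hP)]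
  · rw [if_neg hP]; split_ifs <;> simp [hw]

theorem randomProb_add_not (ρ : ℝ) (P : UniformHypergraph r n → Prop) :
    randomProb r n ρ P + randomProb r n ρ (fun H => ¬ P H) = 1 := by
  classical
  have h := sum_weight_mul_pow (r := r) (n := n) ρ 1 ∅
  simp only [one_pow, mul_one, Finset.card_empty, pow_zero] at h
  rw [randomProb_eq_sum, randomProb_eq_sum, ← Finset.sum_add_distrib, ← h]
  refine Finset.sum_congr rfl fun H _ => ?_
  by_cases hP : P H <;> simp [hP]

theorem randomProb_nonneg (h0 : 0 ≤ ρ) (h1 : ρ ≤ 1) (P : UniformHypergraph r n → Prop) :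
    0 ≤ randomProb r n ρ P := by
  classical
  rw [randomProb_eq_sum]
  refine Finset.sum_nonneg fun H _ => ?_
  split_ifs
  · exact weight_nonneg h0 h1 H
  · exact le_rfl

theorem randomProb_or_le (h0 : 0 ≤ ρ) (h1 : ρ ≤ 1) (P Q : UniformHypergraph r n → Prop) :
    randomProb r n ρ (fun H => P H ∨ Q H) ≤ randomProb r n ρ P + randomProb r n ρ Q := by
  classical
  rw [randomProb_eq_sum, randomProb_eq_sum, randomProb_eq_sum, ← Finset.sum_add_distrib]
  refine Finset.sum_le_sum fun H _ => ?_
  have hw := weight_nonneg h0 h1 H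
  by_cases hP : P H <;> by_cases hQ : Q H <;> simp [hP, hQ, hw]

theorem randomProb_exists_le (h0 : 0 ≤ ρ) (h1 : ρ ≤ 1) {ι : Type*} (s : Finset ι)
    (P : ι → UniformHypergraph r n → Prop) :
    randomProb r n ρ (fun H => ∃ i ∈ s, P i H) ≤ ∑ i ∈ s, randomProb r n ρ (P i) := by
  classical
  induction s using Finset.induction_on with
  | empty => simp [randomProb]
  | insert a s ha ih =>
    rw [Finset.sum_insert ha]
    refine (randomProb_mono h0 h1 fun H hH => ?_).trans
      ((randomProb_or_le h0 h1 (P a) fun H => ∃ i ∈ s, P i H).trans (by gcongr))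
    obtain ⟨i, hi, hP⟩ := hH
    rcases Finset.mem_insert.1 hi with rfl | hi
    · exact .inl hP
    · exact .inr ⟨i, hi, hP⟩

/-- The exponential moment bound, for upper tails (`1 < x`) as well as lower tails (`x < 1`). -/
theorem randomProb_le_exp (h0 : 0 ≤ ρ) (h1 : ρ ≤ 1) {x : ℝ} (hx : 0 < x) (t : ℕ)
    (F : Finset {e : Finset (Fin n) // e.card = r}) {P : UniformHypergraph r n → Prop}
    (hP : ∀ H, P H → x ^ t ≤ x ^ (H ∩ F).card) :
    randomProb r n ρ P ≤ (x ^ t)⁻¹ * Real.exp ((x - 1) * ρ * F.card) := by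
  have hxt : 0 < x ^ t := pow_pos hx t
  refine (randomProb_le_sum h0 h1 (f := fun H => (x ^ t)⁻¹ * x ^ (H ∩ F).card)
    (fun H => by positivity) fun H hH => ?_).trans ?_
  · rw [inv_mul_eq_div, one_le_div hxt]
    exact hP H hH
  · simp only [mul_left_comm (weight ρ _)]
    rw [← Finset.mul_sum, sum_weight_mul_pow, mul_comm _ (F.card : ℝ), Real.exp_nat_mul]
    gcongr
    · nlinarith [mul_nonneg hx.le h0]
    · rw [add_comm]; exact Real.add_one_le_exp _

end UniformHypergraph

theorem eventually_mul_rpow_lt {a b : ℝ} (h : a < b) (C : ℝ) :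
    ∀ᶠ n : ℕ in atTop, C * (n : ℝ) ^ a < (n : ℝ) ^ b := by
  have h1 : Tendsto (fun n : ℕ => (n : ℝ) ^ (b - a)) atTop atTop :=
    (tendsto_rpow_atTop (sub_pos.2 h)).comp tendsto_natCast_atTop_atTop
  filter_upwards [h1.eventually_gt_atTop C, eventually_gt_atTop 0] with n hn h0
  have h0' : (0 : ℝ) < n := by exact_mod_cast h0
  have : (n : ℝ) ^ b = (n : ℝ) ^ (b - a) * (n : ℝ) ^ a := by
    rw [← Real.rpow_add h0']; ring_nf
  rw [this]
  exact mul_lt_mul_of_pos_right hn (Real.rpow_pos_of_pos h0' a)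

namespace UniformHypergraph

variable {r n : ℕ} {ρ : ℝ}

/-- The possible edges inside the set `U`. -/
def possibleEdges (r : ℕ) (U : Finset (Fin n)) : Finset {e : Finset (Fin n) // e.card = r} :=
  Finset.univ.filter fun e => e.1 ⊆ U

theorem edgesIn_eq_inter (H : UniformHypergraph r n) (U : Finset (Fin n)) :
    H.edgesIn U = H ∩ possibleEdges r U := by
  ext e; simp [edgesIn, possibleEdges]

theorem card_possibleEdges_le (U : Finset (Fin n)) :
    (possibleEdges r U).card ≤ U.card ^ r := by
  refine le_trans ?_ ((Finset.card_powersetCard r U).trans_le (Nat.choose_le_pow _ _))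
  refine Finset.card_le_card_of_injOn Subtype.val (fun e he => ?_) Subtype.val_injective.injOn
  exact Finset.mem_coe.2 (Finset.mem_powersetCard.2 ⟨(Finset.mem_filter.1 he).2, e.2⟩)

theorem randomProb_card_lt_le (h0 : 0 ≤ ρ) (h1 : ρ ≤ 1) :
    randomProb r n ρ (fun H => H.card < n) ≤ Real.exp (n - ρ * n.choose r / 2) := by
  refine (randomProb_le_exp h0 h1 (x := 1 / 2) (by norm_num) n Finset.univ fun H hH => ?_).trans ?_
  · rw [Finset.inter_univ]
    exact pow_le_pow_of_le_one (by norm_num) (by norm_num) hH.le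
  · rw [card_edges, sub_eq_add_neg (n : ℝ) (ρ * n.choose r / 2), Real.exp_add]
    have h2 : ((1 / 2 : ℝ) ^ n)⁻¹ ≤ Real.exp n := by
      rw [← inv_pow, ← Real.exp_one_pow]
      have := Real.add_one_le_exp 1
      gcongr
      norm_num at this ⊢
      linarith
    gcongr
    linarith

theorem randomProb_lt_card_le (h0 : 0 ≤ ρ) (h1 : ρ ≤ 1) (t : ℕ) :
    randomProb r n ρ (fun H => t < H.card) ≤ Real.exp (2 * (ρ * n.choose r) - t) := by
  have he : 1 ≤ Real.exp 1 := Real.one_le_exp zero_le_one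
  refine (randomProb_le_exp h0 h1 (Real.exp_pos 1) t Finset.univ fun H hH => ?_).trans ?_
  · rw [Finset.inter_univ]
    exact pow_le_pow_right₀ he hH.le
  · rw [card_edges, sub_eq_add_neg _ (t : ℝ), Real.exp_add, mul_comm, Real.exp_one_pow,
      Real.exp_neg]
    have := Real.exp_one_lt_d9
    have hc : 0 ≤ ρ * n.choose r := by positivity
    have hle : (Real.exp 1 - 1) * ρ * n.choose r ≤ 2 * (ρ * n.choose r) := by
      rw [mul_assoc]
      exact mul_le_mul_of_nonneg_right (by linarith) hc
    exact mul_le_mul_of_nonneg_right (Real.exp_le_exp.2 hle) (by positivity)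

/-- The union bound over all sets of fewer than `p` vertices. -/
theorem randomProb_small_cover_le (h0 : 0 ≤ ρ) (h1 : ρ ≤ 1) {p : ℕ} (hp : 1 ≤ p) (hpn : p ≤ n)
    (hρ : n * ρ * (p : ℝ) ^ r ≤ 1) :
    randomProb r n ρ (fun H => ∃ U : Finset (Fin n), p ≤ (H.edgesIn U).card ∧ U.card < p) ≤
      Real.exp 1 / n := by
  have hn : (1 : ℝ) ≤ n := by exact_mod_cast hp.trans hpn
  have hn0 : (0 : ℝ) < n := by linarith
  have key : ∀ U ∈ Finset.powersetCard (p - 1) (Finset.univ : Finset (Fin n)),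
      randomProb r n ρ (fun H => p ≤ (H.edgesIn U).card) ≤ ((n : ℝ) ^ p)⁻¹ * Real.exp 1 := by
    intro U hU
    refine (randomProb_le_exp h0 h1 hn0 p (possibleEdges r U) fun H hH => ?_).trans ?_
    · rw [← edgesIn_eq_inter]
      exact pow_le_pow_right₀ hn hH
    · have hU' : U.card ≤ p := (Finset.mem_powersetCard.1 hU).2.trans_le (Nat.sub_le _ _)
      have h2 : ((possibleEdges r U).card : ℝ) ≤ (p : ℝ) ^ r := by
        exact_mod_cast (card_possibleEdges_le U).trans (Nat.pow_le_pow_left hU' r)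
      gcongr
      refine le_trans ?_ hρ
      have : (n - 1) * ρ ≤ n * ρ := by nlinarith
      have h3 : 0 ≤ n * ρ := by positivity
      exact mul_le_mul this h2 (by positivity) h3
  have hsum := (randomProb_exists_le h0 h1 (Finset.powersetCard (p - 1) Finset.univ)
    fun (U : Finset (Fin n)) (H : UniformHypergraph r n) => p ≤ (H.edgesIn U).card).trans
      (Finset.sum_le_card_nsmul _ _ _ key)
  refine (randomProb_mono h0 h1 fun H hH => ?_).trans (hsum.trans ?_)
  · obtain ⟨U, hU, hUp⟩ := hH
    obtain ⟨U', hUU', hc⟩ := Finset.exists_superset_card_eq (n := p - 1) (s := U) (by omega)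
      (by rw [Fintype.card_fin]; omega)
    refine ⟨U', Finset.mem_powersetCard.2 ⟨Finset.subset_univ _, hc⟩, hU.trans ?_⟩
    refine Finset.card_le_card fun e he => ?_
    have := Finset.mem_filter.1 he
    exact Finset.mem_filter.2 ⟨this.1, this.2.trans hUU'⟩
  · rw [Finset.card_powersetCard, Finset.card_univ, Fintype.card_fin, nsmul_eq_mul]
    have h2 : (n.choose (p - 1) : ℝ) ≤ (n : ℝ) ^ (p - 1) := by
      exact_mod_cast Nat.choose_le_pow _ _
    have h3 : (n : ℝ) ^ p = n ^ (p - 1) * n := by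
      rw [← pow_succ]; congr 1; omega
    calc (n.choose (p - 1) : ℝ) * (((n : ℝ) ^ p)⁻¹ * Real.exp 1)
        ≤ (n : ℝ) ^ (p - 1) * (((n : ℝ) ^ p)⁻¹ * Real.exp 1) := by gcongr
      _ = Real.exp 1 / n := by
        rw [h3]; field_simp

/-- The random hypergraph with log-density `α < 1` has between `n` and `n ^ 2` edges, and any `p n`
of them cover at least `p n` vertices, with probability tending to one. -/
theorem tendsto_randomProb_spread {α δ : ℝ} (hr : 2 ≤ r) (hα0 : 0 < α) (hα1 : α < 1)
    (hδ : 0 < δ) (hαδ : α + 2 ≤ δ * r) (p : ℕ → ℕ) (hp1 : ∀ᶠ n in atTop, 1 ≤ p n)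
    (hp : ∀ᶠ n : ℕ in atTop, (p n : ℝ) ≤ (n : ℝ) ^ (1 - δ)) :
    Tendsto (fun n : ℕ => randomProb r n ((n : ℝ) ^ (α - ((r : ℝ) - 1))) fun H =>
      n ≤ H.card ∧ H.card ≤ n * n ∧
        ∀ U : Finset (Fin n), p n ≤ (H.edgesIn U).card → p n ≤ U.card) atTop (𝓝 1) := by
  have hr' : (2 : ℝ) ≤ r := by exact_mod_cast hr
  set c : ℝ := (2 ^ r * (r.factorial : ℝ))⁻¹ / 2 with hc
  have hc0 : 0 < c := by positivity
  have l1 : Tendsto (fun n : ℕ => Real.exp ((n : ℝ) - c * (n : ℝ) ^ (1 + α))) atTop (𝓝 0) := by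
    refine Real.tendsto_exp_atBot.comp ?_
    have h1 : Tendsto (fun n : ℕ => -(n : ℝ)) atTop atBot :=
      tendsto_neg_atTop_atBot.comp tendsto_natCast_atTop_atTop
    refine tendsto_atBot_mono' _ ?_ h1
    filter_upwards [eventually_mul_rpow_lt (show (1 : ℝ) < 1 + α by linarith) (2 / c)] with n hn
    rw [Real.rpow_one, div_mul_eq_mul_div, div_lt_iff₀ hc0] at hn
    linarith
  have l2 : Tendsto (fun n : ℕ => Real.exp (2 * (n : ℝ) ^ (1 + α) - ((n * n : ℕ) : ℝ)))
      atTop (𝓝 0) := by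
    refine Real.tendsto_exp_atBot.comp ?_
    have h1 : Tendsto (fun n : ℕ => -(n : ℝ)) atTop atBot :=
      tendsto_neg_atTop_atBot.comp tendsto_natCast_atTop_atTop
    refine tendsto_atBot_mono' _ ?_ h1
    filter_upwards [eventually_mul_rpow_lt (show 1 + α < (2 : ℝ) by linarith) 4,
      eventually_mul_rpow_lt (show (1 : ℝ) < 2 by linarith) 2] with n hn hn'
    rw [Real.rpow_two] at hn hn'
    rw [Real.rpow_one] at hn'
    push_cast
    nlinarith
  have l3 : Tendsto (fun n : ℕ => Real.exp 1 / (n : ℝ)) atTop (𝓝 0) :=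
    tendsto_const_nhds.div_atTop tendsto_natCast_atTop_atTop
  have l : Tendsto (fun n : ℕ => 1 - (Real.exp ((n : ℝ) - c * (n : ℝ) ^ (1 + α)) +
      (Real.exp (2 * (n : ℝ) ^ (1 + α) - ((n * n : ℕ) : ℝ)) + Real.exp 1 / (n : ℝ))))
      atTop (𝓝 1) := by
    simpa using (tendsto_const_nhds (x := (1 : ℝ))).sub (l1.add (l2.add l3))
  have hev : ∀ᶠ n : ℕ in atTop, 0 ≤ (n : ℝ) ^ (α - ((r : ℝ) - 1)) ∧
      (n : ℝ) ^ (α - ((r : ℝ) - 1)) ≤ 1 := by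
    filter_upwards [eventually_ge_atTop 1] with n hn
    have hn' : (1 : ℝ) ≤ n := by exact_mod_cast hn
    exact ⟨by positivity, Real.rpow_le_one_of_one_le_of_nonpos hn' (by linarith)⟩
  refine tendsto_of_tendsto_of_tendsto_of_le_of_le' l tendsto_const_nhds ?_ ?_
  · filter_upwards [hev, hp1, hp, eventually_ge_atTop (max 1 (2 * r))] with n ⟨h0, h1⟩ hp1 hp hn
    have hn1 : 1 ≤ n := le_of_max_le_left hn
    have hn' : (1 : ℝ) ≤ n := by exact_mod_cast hn1
    have hn0 : (0 : ℝ) < n := by linarith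
    set ρ := (n : ℝ) ^ (α - ((r : ℝ) - 1)) with hρ
    have hpow : ρ * (n : ℝ) ^ r = (n : ℝ) ^ (1 + α) := by
      rw [hρ, ← Real.rpow_natCast, ← Real.rpow_add hn0]; ring_nf
    have hup : ρ * n.choose r ≤ (n : ℝ) ^ (1 + α) := by
      rw [← hpow]
      gcongr
      exact_mod_cast Nat.choose_le_pow n r
    have hlow : c * (n : ℝ) ^ (1 + α) ≤ ρ * n.choose r / 2 := by
      have h2 : ((n : ℝ) / 2) ^ r / r.factorial ≤ n.choose r := by
        refine le_trans ?_ (Nat.pow_le_choose r n)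
        have h4 : n ≤ 2 * (n + 1 - r) := by
          have := le_of_max_le_right hn
          omega
        have h5 : (n : ℝ) / 2 ≤ ((n + 1 - r : ℕ) : ℝ) := by
          rw [div_le_iff₀ two_pos, mul_comm]
          exact_mod_cast h4
        gcongr
      have h3 : c * (n : ℝ) ^ (1 + α) = ρ * (((n : ℝ) / 2) ^ r / r.factorial) / 2 := by
        rw [← hpow, hc, div_pow]; field_simp
      rw [h3]
      gcongr
    have hpn : p n ≤ n := by
      have : (p n : ℝ) ≤ n := hp.trans
        ((Real.rpow_le_rpow_of_exponent_le hn' (show 1 - δ ≤ 1 by linarith)).trans_eq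
          (Real.rpow_one _))
      exact_mod_cast this
    have hρp : n * ρ * (p n : ℝ) ^ r ≤ 1 := by
      calc n * ρ * (p n : ℝ) ^ r ≤ n * ρ * ((n : ℝ) ^ (1 - δ)) ^ r := by gcongr
        _ = (n : ℝ) ^ (α + 2 - δ * r) := by
          rw [← Real.rpow_natCast, ← Real.rpow_mul hn0.le, hρ]
          nth_rewrite 1 [← Real.rpow_one (n : ℝ)]
          rw [← Real.rpow_add hn0, ← Real.rpow_add hn0]
          ring_nf
        _ ≤ 1 := Real.rpow_le_one_of_one_le_of_nonpos hn' (by linarith)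
    have hnot := randomProb_add_not (r := r) (n := n) ρ fun H =>
      n ≤ H.card ∧ H.card ≤ n * n ∧
        ∀ U : Finset (Fin n), p n ≤ (H.edgesIn U).card → p n ≤ U.card
    have b1 := randomProb_card_lt_le (r := r) (n := n) h0 h1
    have b2 := randomProb_lt_card_le (r := r) (n := n) h0 h1 (n * n)
    have b3 := randomProb_small_cover_le (r := r) (n := n) h0 h1 hp1 hpn hρp
    have e1 : Real.exp (n - ρ * n.choose r / 2) ≤ Real.exp ((n : ℝ) - c * (n : ℝ) ^ (1 + α)) :=
      Real.exp_le_exp.2 (by linarith)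
    have e2 : Real.exp (2 * (ρ * n.choose r) - ((n * n : ℕ) : ℝ)) ≤
        Real.exp (2 * (n : ℝ) ^ (1 + α) - ((n * n : ℕ) : ℝ)) :=
      Real.exp_le_exp.2 (by linarith)
    have hor : randomProb r n ρ (fun H => ¬ (n ≤ H.card ∧ H.card ≤ n * n ∧
        ∀ U : Finset (Fin n), p n ≤ (H.edgesIn U).card → p n ≤ U.card)) ≤ _ :=
      (randomProb_mono h0 h1 fun H hH => ?_).trans
        ((randomProb_or_le h0 h1 (fun H => H.card < n) fun H => n * n < H.card ∨
          ∃ U : Finset (Fin n), p n ≤ (H.edgesIn U).card ∧ U.card < p n).trans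
        (add_le_add_right (randomProb_or_le h0 h1 (fun H => n * n < H.card)
          fun H => ∃ U : Finset (Fin n), p n ≤ (H.edgesIn U).card ∧ U.card < p n) _))
    · linarith
    · by_contra hcon
      push Not at hcon
      exact hH ⟨hcon.1, hcon.2.1, hcon.2.2⟩
  · filter_upwards [hev] with n ⟨h0, h1⟩
    have := randomProb_add_not (r := r) (n := n) ((n : ℝ) ^ (α - ((r : ℝ) - 1))) fun H =>
      n ≤ H.card ∧ H.card ≤ n * n ∧
        ∀ U : Finset (Fin n), p n ≤ (H.edgesIn U).card → p n ≤ U.card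
    have h2 := randomProb_nonneg (r := r) (n := n) h0 h1 fun H =>
      ¬ (n ≤ H.card ∧ H.card ≤ n * n ∧
        ∀ U : Finset (Fin n), p n ≤ (H.edgesIn U).card → p n ≤ U.card)
    linarith

end UniformHypergraph

/-! ### The choice of the parameters -/

/-- The planted size `k = ⌊n ^ (1 / 2 - θ)⌋`. -/
def plantedSize (θ : ℝ) (n : ℕ) : ℕ := ⌊(n : ℝ) ^ (1 / 2 - θ)⌋₊

theorem plantedSize_le {θ : ℝ} (n : ℕ) : (plantedSize θ n : ℝ) ≤ (n : ℝ) ^ (1 / 2 - θ) :=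
  Nat.floor_le (by positivity)

theorem eventually_le_plantedSize {θ : ℝ} (hθ : θ < 1 / 2) :
    ∀ᶠ n : ℕ in atTop, (n : ℝ) ^ (1 / 2 - θ) / 2 ≤ plantedSize θ n := by
  filter_upwards [eventually_mul_rpow_lt (show (0 : ℝ) < 1 / 2 - θ by linarith) 2] with n hn
  have := Nat.lt_floor_add_one ((n : ℝ) ^ (1 / 2 - θ))
  rw [Real.rpow_zero] at hn
  rw [plantedSize]
  linarith

/-- The threshold `p = ⌊k ^ 4 / n⌋`, which is `n ^ (1 - 4 * θ)` up to a constant. -/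
def threshold (θ : ℝ) (n : ℕ) : ℕ := plantedSize θ n ^ 4 / n

theorem rpow_pow_four {θ : ℝ} {n : ℕ} (hn : 1 ≤ n) :
    ((n : ℝ) ^ (1 / 2 - θ)) ^ 4 = (n : ℝ) ^ (1 - 4 * θ) * n := by
  have hn0 : (0 : ℝ) < n := by exact_mod_cast hn
  nth_rewrite 3 [← Real.rpow_one (n : ℝ)]
  rw [← Real.rpow_natCast, ← Real.rpow_mul hn0.le, ← Real.rpow_add hn0]
  congr 1
  push_cast
  ring

theorem threshold_le {θ : ℝ} {n : ℕ} (hn : 1 ≤ n) :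
    (threshold θ n : ℝ) ≤ (n : ℝ) ^ (1 - 4 * θ) := by
  have hn0 : (0 : ℝ) < n := by exact_mod_cast hn
  refine Nat.cast_div_le.trans ?_
  rw [div_le_iff₀ hn0, ← rpow_pow_four hn]
  push_cast
  exact pow_le_pow_left₀ (Nat.cast_nonneg _) (plantedSize_le n) 4

theorem eventually_le_threshold {θ : ℝ} (hθ : θ < 1 / 4) :
    ∀ᶠ n : ℕ in atTop, (n : ℝ) ^ (1 - 4 * θ) / 32 ≤ threshold θ n := by
  filter_upwards [eventually_le_plantedSize (show θ < 1 / 2 by linarith),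
    eventually_mul_rpow_lt (show (0 : ℝ) < 1 - 4 * θ by linarith) 32,
    eventually_ge_atTop 1] with n hk h32 hn
  have hn0 : (0 : ℝ) < n := by exact_mod_cast hn
  have h1 : (n : ℝ) ^ (1 - 4 * θ) / 16 ≤ (plantedSize θ n : ℝ) ^ 4 / n := by
    rw [le_div_iff₀ hn0, div_mul_eq_mul_div, ← rpow_pow_four hn]
    calc ((n : ℝ) ^ (1 / 2 - θ)) ^ 4 / 16 = ((n : ℝ) ^ (1 / 2 - θ) / 2) ^ 4 := by ring
      _ ≤ _ := pow_le_pow_left₀ (by positivity) hk 4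
  have h2 : (plantedSize θ n : ℝ) ^ 4 / n < threshold θ n + 1 := by
    have := Nat.lt_div_mul_add (a := plantedSize θ n ^ 4) (b := n) hn
    rw [div_lt_iff₀ hn0, threshold]
    have h3 : plantedSize θ n ^ 4 < (plantedSize θ n ^ 4 / n + 1) * n := by
      rw [add_mul, one_mul]; exact this
    exact_mod_cast h3
  rw [Real.rpow_zero] at h32
  linarith

/-- For large `n`, the threshold `p` lies below the number of edges of a dense subhypergraph, and
above what an approximation within the factor `C * m ^ (1 / 4 - 2 * θ)` makes of `k`. -/
theorem eventually_parameters {θ : ℝ} (hθ0 : 0 < θ) (hθ : θ ≤ 1 / 16) (r : ℕ) (C : ℝ) (hC : 0 ≤ C) :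
    ∀ᶠ n : ℕ in atTop, 1 ≤ threshold θ n ∧ 2 * threshold θ n ≤ n ∧ plantedSize θ n ≤ n ∧
      0 < plantedSize θ n ∧
      (r * threshold θ n : ℝ) ≤ (plantedSize θ n : ℝ) ^ (1 + (1 - 4 * θ)) ∧
      C * ((n * n + 1 : ℕ) : ℝ) ^ (1 / 4 - 2 * θ) * plantedSize θ n < threshold θ n := by
  filter_upwards [eventually_le_plantedSize (show θ < 1 / 2 by linarith),
    eventually_le_threshold (show θ < 1 / 4 by linarith),
    eventually_mul_rpow_lt (show (0 : ℝ) < 1 - 4 * θ by linarith) 32,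
    eventually_mul_rpow_lt (show 1 - 4 * θ < 1 by linarith) 2,
    eventually_mul_rpow_lt (show 0 < 1 / 2 - θ by linarith) 2,
    eventually_mul_rpow_lt (show 1 - 4 * θ < (1 / 2 - θ) * (1 + (1 - 4 * θ)) by nlinarith) (4 * r),
    eventually_mul_rpow_lt (show 1 - 5 * θ < 1 - 4 * θ by linarith) (64 * C),
    eventually_ge_atTop 1] with n hk hp h1 h2 h3 h4 h5 hn
  have hn' : (1 : ℝ) ≤ n := by exact_mod_cast hn
  have hn0 : (0 : ℝ) < n := one_pos.trans_le hn'
  have hple := threshold_le (θ := θ) hn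
  rw [Real.rpow_zero] at h1 h3
  rw [Real.rpow_one] at h2
  refine ⟨?_, ?_, ?_, ?_, ?_, ?_⟩
  · have : (0 : ℝ) < threshold θ n := by linarith
    exact_mod_cast this
  · have : (2 * threshold θ n : ℝ) ≤ n := by linarith
    exact_mod_cast this
  · have : (plantedSize θ n : ℝ) ≤ n := (plantedSize_le n).trans
      ((Real.rpow_le_rpow_of_exponent_le hn' (show 1 / 2 - θ ≤ 1 by linarith)).trans_eq
        (Real.rpow_one _))
    exact_mod_cast this
  · have : (0 : ℝ) < plantedSize θ n := by linarith
    exact_mod_cast this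
  · have e1 : ((n : ℝ) ^ (1 / 2 - θ) / 2) ^ (1 + (1 - 4 * θ)) ≤
        (plantedSize θ n : ℝ) ^ (1 + (1 - 4 * θ)) :=
      Real.rpow_le_rpow (by positivity) hk (by linarith)
    rw [Real.div_rpow (by positivity) (by norm_num), ← Real.rpow_mul hn0.le] at e1
    have e2 : (2 : ℝ) ^ (1 + (1 - 4 * θ)) ≤ 4 := by
      calc (2 : ℝ) ^ (1 + (1 - 4 * θ)) ≤ 2 ^ (2 : ℝ) :=
            Real.rpow_le_rpow_of_exponent_le (by norm_num) (by linarith)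
        _ = 4 := by norm_num
    have e3 : (n : ℝ) ^ ((1 / 2 - θ) * (1 + (1 - 4 * θ))) / 4 ≤
        (n : ℝ) ^ ((1 / 2 - θ) * (1 + (1 - 4 * θ))) / 2 ^ (1 + (1 - 4 * θ)) := by
      gcongr
    have e4 : (r : ℝ) * threshold θ n ≤ r * (n : ℝ) ^ (1 - 4 * θ) := by gcongr
    linarith
  · have e1 : ((n * n + 1 : ℕ) : ℝ) ^ (1 / 4 - 2 * θ) ≤ 2 * (n : ℝ) ^ (1 / 2 - 4 * θ) := by
      calc ((n * n + 1 : ℕ) : ℝ) ^ (1 / 4 - 2 * θ) ≤ (2 * (n : ℝ) ^ (2 : ℝ)) ^ (1 / 4 - 2 * θ) := by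
            refine Real.rpow_le_rpow (Nat.cast_nonneg _) ?_ (by linarith)
            push_cast
            rw [Real.rpow_two]
            nlinarith
        _ = 2 ^ (1 / 4 - 2 * θ) * (n : ℝ) ^ (1 / 2 - 4 * θ) := by
            rw [Real.mul_rpow (by norm_num) (by positivity), ← Real.rpow_mul hn0.le]
            ring_nf
        _ ≤ 2 ^ (1 : ℝ) * (n : ℝ) ^ (1 / 2 - 4 * θ) := by
            gcongr
            · norm_num
            · linarith
        _ = _ := by rw [Real.rpow_one]
    calc C * ((n * n + 1 : ℕ) : ℝ) ^ (1 / 4 - 2 * θ) * plantedSize θ n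
        ≤ C * (2 * (n : ℝ) ^ (1 / 2 - 4 * θ)) * (n : ℝ) ^ (1 / 2 - θ) := by
          gcongr
          exact plantedSize_le n
      _ = 64 * C * (n : ℝ) ^ (1 - 5 * θ) / 32 := by
          rw [show 1 - 5 * θ = (1 / 2 - 4 * θ) + (1 / 2 - θ) by ring, Real.rpow_add hn0]
          ring
      _ < threshold θ n := by linarith

namespace DenseVsRandomInput

variable {r : ℕ} (I : DenseVsRandomInput r)

/-! ### The reduction -/

open Classical in
/-- The input word, replaced by zeros unless `1 ≤ n ≤ |H|` and `k ≤ n`. Only then are all its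
entries polynomially bounded in its length; the other inputs are answered at once. -/
def cleaned (j : ℕ) : ℕ :=
  if 1 ≤ I.n ∧ I.n ≤ I.H.card ∧ I.k ≤ I.n then I.cell j else 0

theorem cleaned_le (j : ℕ) : I.cleaned j ≤ I.H.card := by
  rw [cleaned]
  split_ifs with h
  · exact I.cell_le h.2.1 (h.2.2.trans h.2.1) le_rfl j
  · exact Nat.zero_le _

end DenseVsRandomInput

/-- The number of vertices stored in the word `B`, or `1` if that is `0`. -/
def vertexCount (B : ℕ → ℕ) : ℕ := if B 0 = 0 then 1 else B 0

/-- The number of edges stored in the word `B`, or `1` if that is `0`. -/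
def edgeCount (B : ℕ → ℕ) : ℕ := if B 2 = 0 then 1 else B 2

/-- The threshold `⌊k ^ 4 / n⌋` for the word `B`. -/
def wordThreshold (B : ℕ → ℕ) : ℕ := B 1 * B 1 * (B 1 * B 1) / vertexCount B

theorem vertexCount_pos (B : ℕ → ℕ) : 0 < vertexCount B := by
  rw [vertexCount]; split_ifs <;> omega

theorem edgeCount_pos (B : ℕ → ℕ) : 0 < edgeCount B := by
  rw [edgeCount]; split_ifs <;> omega

/-- The certificate-selection instance of the hypergraph stored in the word `B`. -/
def wordInstance (r : ℕ) (B : ℕ → ℕ) : DCS2Instance :=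
  gapInstance (vertexCount B) (edgeCount B) (wordThreshold B) (vertexCount_pos B)
    (edgeCount_pos B) (DenseVsRandomInput.Incident r B)

open Classical in
/-- The answer to the Dense-vs-Random problem derived from a verifier `A`: "dense" if the input was
rejected, has more than `n ^ 2` edges, or if the accepted edges cover fewer than `p` vertices. -/
def answer (r : ℕ) (B : ℕ → ℕ) (A : Fin (edgeCount B + 1) → Bool) : Bool :=
  decide (B 0 = 0 ∨ vertexCount B * vertexCount B < edgeCount B ∨
    (covered (vertexCount B) (DenseVsRandomInput.Incident r B) (accepted A)).card <
      wordThreshold B)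

namespace RAM

namespace Ex

/-! ### The expressions used by the reduction -/

/-- The remainder `e % f`. -/
def mod (e f : Ex) : Ex := .sub e (mul (div e f) f)

theorem eval_mod (e f : Ex) (s : State) (hf : 0 < f.eval s) :
    (mod e f).eval s = e.eval s % f.eval s := by
  rw [mod, eval, eval_mul, eval_div _ _ _ hf]
  have := Nat.div_add_mod' (e.eval s) (f.eval s)
  omega

theorem Uses.mod {e f : Ex} {R X : ℕ → Prop} (he : e.Uses R X) (hf : f.Uses R X) :
    (mod e f).Uses R X :=
  ⟨he, .mul (.div he hf) hf⟩

/-- The entry of index `j` of the list `l`, and `rest` beyond the end of the list. -/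
def select : List Ex → Ex → Ex → Ex
  | [], _, rest => rest
  | e :: l, j, rest => .ite j e (select l (.sub j (.lit 1)) rest)

theorem eval_select (rest : Ex) (s : State) : ∀ (l : List Ex) (j : Ex),
    (select l j rest).eval s =
      if j.eval s < l.length then (l.map fun e => e.eval s).getD (j.eval s) 0 else rest.eval s
  | [], j => by simp [select]
  | e :: l, j => by
    rw [select, eval, eval_select rest s l]
    simp only [eval]
    rcases Nat.eq_zero_or_pos (j.eval s) with h | h
    · simp [h]
    · obtain ⟨i, hi⟩ := Nat.exists_eq_succ_of_ne_zero h.ne'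
      simp [hi]

theorem Uses.select {R X : ℕ → Prop} {rest : Ex} (hr : rest.Uses R X) :
    ∀ {l : List Ex} {j : Ex}, (∀ e ∈ l, e.Uses R X) → j.Uses R X → (select l j rest).Uses R X
  | [], _, _, _ => hr
  | e :: l, j, hl, hj =>
    ⟨hj, hl e (by simp), Uses.select hr (fun e he => hl e (by simp [he])) ⟨hj, trivial⟩⟩

theorem eval_ite_zero {e f g : Ex} {s : State} (h : e.eval s = 0) :
    (ite e f g).eval s = f.eval s := by rw [eval, if_pos h]

theorem eval_ite_ne {e f g : Ex} {s : State} (h : e.eval s ≠ 0) :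
    (ite e f g).eval s = g.eval s := by rw [eval, if_neg h]

theorem eval_ite_le_pos {a b f g : Ex} {s : State} (h : a.eval s ≤ b.eval s) :
    (ite (le a b) f g).eval s = g.eval s :=
  eval_ite_ne (by rw [eval_le, if_pos h]; exact one_ne_zero)

theorem eval_ite_le_neg {a b f g : Ex} {s : State} (h : ¬ a.eval s ≤ b.eval s) :
    (ite (le a b) f g).eval s = f.eval s :=
  eval_ite_zero (by rw [eval_le, if_neg h])

variable (K r : ℕ)

/-- The vertex count of the word in array `K`. -/
def vertexCountE : Ex := .ite (.arr K (.lit 0)) (.lit 1) (.arr K (.lit 0))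

/-- The edge count of the word in array `K`. -/
def edgeCountE : Ex := .ite (.arr K (.lit 2)) (.lit 1) (.arr K (.lit 2))

/-- The number of certificates. -/
def widthE : Ex := .add (edgeCountE K) (.lit 1)

/-- The threshold of the word in array `K`. -/
def thresholdE : Ex :=
  div (mul (mul (.arr K (.lit 1)) (.arr K (.lit 1))) (mul (.arr K (.lit 1)) (.arr K (.lit 1))))
    (vertexCountE K)

/-- The number of occurrences of `y` among the first `j` vertices of the edge `φ` of the word in
array `K`. -/
def incidentE (φ y : Ex) : ℕ → Ex
  | 0 => .lit 0
  | j + 1 => .add (incidentE φ y j)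
      (eq (.arr K (.add (.add (.lit 3) (mul φ (.lit r))) (.lit j))) y)

/-- The number of in-class datapoints. -/
def inCountE : Ex :=
  .add (edgeCountE K) (.sub (edgeCountE K) (.add (thresholdE K) (thresholdE K)))

/-- The length of the word that encodes the certificate-selection instance. -/
def lengthE : Ex :=
  .add (.add (.lit 9) (mul (inCountE K) (widthE K)))
    (mul (vertexCountE K) (widthE K))

/-- The adjacency of in-class datapoints and certificates, at position `j` of the matrix. -/
def inEntryE (j : Ex) : Ex :=
  eq (mod j (widthE K))
    (.ite (le (div j (widthE K)) (edgeCountE K)) (edgeCountE K)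
      (div j (widthE K)))

/-- The adjacency of out-class datapoints and certificates, at position `j` of the matrix. -/
def outEntryE (j : Ex) : Ex :=
  .ite (le (.add (mod j (widthE K)) (.lit 1)) (edgeCountE K)) (.lit 0)
    (.ite (incidentE K r (mod j (widthE K))
      (div j (widthE K)) r) (.lit 0) (.lit 1))

/-- The entry at position `j` of the word that encodes the certificate-selection instance. -/
def entryE (j : Ex) : Ex :=
  select [inCountE K, widthE K, vertexCountE K, .lit 1, .lit 2, .lit 1, .lit 1,
      .lit 0, .lit 1] j
    (.ite (le (.add (.sub j (.lit 9)) (.lit 1))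
        (mul (inCountE K) (widthE K)))
      (outEntryE K r (.sub (.sub j (.lit 9)) (mul (inCountE K) (widthE K))))
      (inEntryE K (.sub j (.lit 9))))

/-- The input word, cleaned, at position `j`; the input is in array `0`. -/
def cleanedE (j : Ex) : Ex :=
  .ite (.arr 0 (.lit 0)) (.lit 0)
    (.ite (.sub (.arr 0 (.lit 0)) (.arr 0 (.lit 2)))
      (.ite (.sub (.arr 0 (.lit 1)) (.arr 0 (.lit 0))) (.arr 0 j) (.lit 0)) (.lit 0))

/-- The number of vertices covered by the edges marked in array `K + 1`. -/
def coveredE : Ex :=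
  .sum (K + 1) (vertexCountE K)
    (.ite (.sum (K + 2) (edgeCountE K)
        (.ite (.arr (K + 1) (.var (K + 2))) (.lit 0)
          (incidentE K r (.var (K + 2)) (.var (K + 1)) r)))
      (.lit 0) (.lit 1))

/-- The answer derived from the verifier in array `K + 1`. -/
def answerE : Ex :=
  .ite (.arr K (.lit 0)) (.lit 1)
    (.ite (le (edgeCountE K) (mul (vertexCountE K) (vertexCountE K))) (.lit 1)
      (.ite (le (thresholdE K) (coveredE K r)) (.lit 1) (.lit 0)))

variable {K r} {s : State}

theorem eval_vertexCountE : (vertexCountE K).eval s = vertexCount (s.arr K) := rfl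

theorem eval_edgeCountE : (edgeCountE K).eval s = edgeCount (s.arr K) := rfl

theorem eval_widthE : (widthE K).eval s = edgeCount (s.arr K) + 1 := rfl

theorem eval_thresholdE : (thresholdE K).eval s = wordThreshold (s.arr K) := by
  have h : 0 < (vertexCountE K).eval s := vertexCount_pos _
  rw [thresholdE, eval_div _ _ _ h]
  simp [eval, wordThreshold, eval_vertexCountE]

theorem eval_incidentE (φ y : Ex) (s : State) : ∀ j : ℕ,
    (incidentE K r φ y j).eval s ≠ 0 ↔
      ∃ i < j, s.arr K (3 + φ.eval s * r + i) = y.eval s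
  | 0 => by simp [incidentE, eval]
  | j + 1 => by
    have := eval_incidentE φ y s j
    simp only [incidentE, eval, eval_eq, eval_mul, ne_eq, Nat.add_eq_zero_iff, not_and_or] at this ⊢
    rw [this]
    constructor
    · rintro (⟨i, hi, h⟩ | h)
      · exact ⟨i, by omega, h⟩
      · exact ⟨j, by omega, by by_contra hc; simp [hc] at h⟩
    · rintro ⟨i, hi, h⟩
      rcases Nat.lt_succ_iff_lt_or_eq.1 hi with hi | rfl
      · exact .inl ⟨i, hi, h⟩
      · exact .inr (by simp [h])

theorem eval_inCountE : (inCountE K).eval s =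
    edgeCount (s.arr K) + (edgeCount (s.arr K) - 2 * wordThreshold (s.arr K)) := by
  simp only [inCountE, eval, eval_edgeCountE, eval_thresholdE, two_mul]

theorem eval_lengthE : (lengthE K).eval s = (wordInstance r (s.arr K)).encode.length := by
  rw [wordInstance, length_encode_gapInstance]
  simp only [lengthE, eval, eval_mul, eval_inCountE, eval_widthE, eval_vertexCountE]

theorem eval_inEntryE (j : Ex) : (inEntryE K j).eval s =
    if j.eval s % (edgeCount (s.arr K) + 1) =
      min (j.eval s / (edgeCount (s.arr K) + 1)) (edgeCount (s.arr K)) then 1 else 0 := by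
  have h : 0 < (widthE K).eval s := Nat.succ_pos _
  have h2 : (Ex.ite (le (div j (widthE K)) (edgeCountE K)) (edgeCountE K)
      (div j (widthE K))).eval s =
      min (j.eval s / (edgeCount (s.arr K) + 1)) (edgeCount (s.arr K)) := by
    by_cases h1 : (div j (widthE K)).eval s ≤ (edgeCountE K).eval s
    · rw [eval_ite_le_pos h1]
      rw [eval_div _ _ _ h] at h1 ⊢
      exact (min_eq_left h1).symm
    · rw [eval_ite_le_neg h1]
      rw [eval_div _ _ _ h] at h1
      exact (min_eq_right (not_le.1 h1).le).symm
  rw [inEntryE, eval_eq, h2, eval_mod _ _ _ h, eval_widthE]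

open Classical in
theorem eval_outEntryE (j : Ex) : (outEntryE K r j).eval s =
    if j.eval s % (edgeCount (s.arr K) + 1) < edgeCount (s.arr K) ∧
      DenseVsRandomInput.Incident r (s.arr K) (j.eval s % (edgeCount (s.arr K) + 1))
        (j.eval s / (edgeCount (s.arr K) + 1)) then 1 else 0 := by
  have h : 0 < (widthE K).eval s := Nat.succ_pos _
  have h1 := eval_incidentE (K := K) (r := r) (mod j (widthE K)) (div j (widthE K)) s r
  have h2 : (Ex.add (mod j (widthE K)) (.lit 1)).eval s ≤ (edgeCountE K).eval s ↔
      j.eval s % (edgeCount (s.arr K) + 1) < edgeCount (s.arr K) := by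
    rw [eval, eval_mod _ _ _ h]; exact Iff.rfl
  rw [eval_mod _ _ _ h, eval_div _ _ _ h] at h1
  change _ ↔ DenseVsRandomInput.Incident r (s.arr K) (j.eval s % (edgeCount (s.arr K) + 1))
        (j.eval s / (edgeCount (s.arr K) + 1)) at h1
  rw [outEntryE]
  by_cases h3 : j.eval s % (edgeCount (s.arr K) + 1) < edgeCount (s.arr K)
  · rw [eval_ite_le_pos (h2.2 h3)]
    by_cases h4 : DenseVsRandomInput.Incident r (s.arr K) (j.eval s % (edgeCount (s.arr K) + 1))
        (j.eval s / (edgeCount (s.arr K) + 1))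
    · rw [eval_ite_ne (h1.2 h4), if_pos ⟨h3, h4⟩]; rfl
    · rw [eval_ite_zero (not_not.1 (mt h1.1 h4)), if_neg fun h => h4 h.2]; rfl
  · rw [eval_ite_le_neg (mt h2.1 h3), if_neg fun h => h3 h.1]; rfl

theorem eval_entryE (j : Ex) (hj : j.eval s < (wordInstance r (s.arr K)).encode.length) :
    (entryE K r j).eval s = (wordInstance r (s.arr K)).encode.getD (j.eval s) 0 := by
  classical
  rw [wordInstance, length_encode_gapInstance] at hj
  rw [wordInstance, getD_encode_gapInstance, entryE, eval_select, gapWord]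
  simp only [List.length_cons, List.length_nil, List.map_cons, List.map_nil, eval_inCountE]
  have hA : (mul (inCountE K) (widthE K)).eval s = (edgeCount (s.arr K) +
      (edgeCount (s.arr K) - 2 * wordThreshold (s.arr K))) * (edgeCount (s.arr K) + 1) := by
    rw [eval_mul, eval_inCountE, eval_widthE]
  by_cases h1 : j.eval s < 9
  · rw [if_pos h1, if_pos h1]; rfl
  · rw [if_neg h1, if_neg h1]
    have h3 : (Ex.add (.sub j (.lit 9)) (.lit 1)).eval s ≤ (mul (inCountE K) (widthE K)).eval s ↔
        j.eval s - 9 < (edgeCount (s.arr K) +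
          (edgeCount (s.arr K) - 2 * wordThreshold (s.arr K))) * (edgeCount (s.arr K) + 1) := by
      rw [hA]; exact Iff.rfl
    by_cases h2 : j.eval s - 9 < (edgeCount (s.arr K) +
        (edgeCount (s.arr K) - 2 * wordThreshold (s.arr K))) * (edgeCount (s.arr K) + 1)
    · rw [if_pos h2, eval_ite_le_pos (h3.2 h2), eval_inEntryE]
      rfl
    · have h4 : (Ex.sub (.sub j (.lit 9)) (mul (inCountE K) (widthE K))).eval s =
          j.eval s - 9 - (edgeCount (s.arr K) +
          (edgeCount (s.arr K) - 2 * wordThreshold (s.arr K))) * (edgeCount (s.arr K) + 1) := by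
        rw [eval, hA]; rfl
      rw [if_neg h2, eval_ite_le_neg (mt h3.1 h2), if_pos (by omega), eval_outEntryE, h4]

theorem eval_coveredE {A : Fin (edgeCount (s.arr K) + 1) → Bool}
    (hA : ∀ φ (h : φ < edgeCount (s.arr K)), s.arr (K + 1) φ = (A ⟨φ, by omega⟩).toNat) :
    (coveredE K r).eval s = (covered (vertexCount (s.arr K))
      (DenseVsRandomInput.Incident r (s.arr K)) (accepted A)).card := by
  classical
  rw [coveredE, eval, covered, Finset.card_filter, eval_vertexCountE]
  refine Finset.sum_congr rfl fun y _ => ?_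
  have key : (Ex.sum (K + 2) (edgeCountE K)
        (.ite (.arr (K + 1) (.var (K + 2))) (.lit 0)
          (incidentE K r (.var (K + 2)) (.var (K + 1)) r))).eval (s.setVar (K + 1) y) = 0 ↔
      ¬ ∃ φ ∈ accepted A, DenseVsRandomInput.Incident r (s.arr K) φ y := by
    rw [eval, Finset.sum_eq_zero_iff, eval_edgeCountE, State.setVar_arr]
    push Not
    refine forall_congr' fun φ => ?_
    simp only [accepted, Finset.mem_filter, Finset.mem_range, and_imp]
    refine forall_congr' fun hφ => ?_
    have h1 := eval_incidentE (K := K) (r := r) (.var (K + 2)) (.var (K + 1))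
      ((s.setVar (K + 1) y).setVar (K + 2) φ) r
    have h2 : (Ex.arr (K + 1) (.var (K + 2))).eval ((s.setVar (K + 1) y).setVar (K + 2) φ) =
        (A ⟨φ, by omega⟩).toNat := by
      rw [← hA φ hφ]; simp [eval]
    have h3 : (Ex.var (K + 2)).eval ((s.setVar (K + 1) y).setVar (K + 2) φ) = φ := by
      simp [eval]
    have h4 : (Ex.var (K + 1)).eval ((s.setVar (K + 1) y).setVar (K + 2) φ) = y := by
      simp [eval]
    rw [h3, h4] at h1
    change _ ↔ DenseVsRandomInput.Incident r (s.arr K) φ y at h1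
    cases hAφ : A ⟨φ, by omega⟩
    · rw [eval_ite_zero (by rw [h2, hAφ]; rfl)]
      simp [eval, hAφ]
    · rw [eval_ite_ne (by rw [h2, hAφ]; exact one_ne_zero), ← h1]
      simp only [not_not, ne_eq]
      exact ⟨fun h _ => h, fun h => h ⟨by omega, hAφ⟩⟩
  by_cases h : ∃ φ ∈ accepted A, DenseVsRandomInput.Incident r (s.arr K) φ y
  · rw [if_pos h, eval_ite_ne (fun h0 => (key.1 h0) h)]; rfl
  · rw [if_neg h, eval_ite_zero (key.2 h)]; rfl

theorem eval_answerE {A : Fin (edgeCount (s.arr K) + 1) → Bool}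
    (hA : ∀ φ (h : φ < edgeCount (s.arr K)), s.arr (K + 1) φ = (A ⟨φ, by omega⟩).toNat) :
    (answerE K r).eval s = (answer r (s.arr K) A).toNat := by
  have hc := eval_coveredE (r := r) hA
  have hm : (mul (vertexCountE K) (vertexCountE K)).eval s =
      vertexCount (s.arr K) * vertexCount (s.arr K) := eval_mul _ _ _
  rw [answerE, answer]
  by_cases h1 : s.arr K 0 = 0
  · rw [eval_ite_zero (show (Ex.arr K (.lit 0)).eval s = 0 from h1),
      decide_eq_true (Or.inl h1)]
    rfl
  rw [eval_ite_ne (show (Ex.arr K (.lit 0)).eval s ≠ 0 from h1)]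
  by_cases h2 : vertexCount (s.arr K) * vertexCount (s.arr K) < edgeCount (s.arr K)
  · rw [eval_ite_le_neg (by rw [hm, eval_edgeCountE]; exact not_le.2 h2),
      decide_eq_true (Or.inr (Or.inl h2))]
    rfl
  rw [eval_ite_le_pos (by rw [hm, eval_edgeCountE]; exact not_lt.1 h2)]
  by_cases h3 : (covered (vertexCount (s.arr K)) (DenseVsRandomInput.Incident r (s.arr K))
        (accepted A)).card < wordThreshold (s.arr K)
  · rw [eval_ite_le_neg (by rw [hc, eval_thresholdE]; exact not_le.2 h3),
      decide_eq_true (Or.inr (Or.inr h3))]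
    rfl
  · rw [eval_ite_le_pos (by rw [hc, eval_thresholdE]; exact not_lt.1 h3),
      decide_eq_false (by tauto)]
    rfl

variable {X R : ℕ → Prop}

theorem uses_vertexCountE (hK : R K) : (vertexCountE K).Uses R X := by
  simp [vertexCountE, Uses, hK]

theorem uses_edgeCountE (hK : R K) : (edgeCountE K).Uses R X := by
  simp [edgeCountE, Uses, hK]

theorem uses_thresholdE (hK : R K) : (thresholdE K).Uses R X := by
  have h : (Ex.arr K (.lit 1)).Uses R X := ⟨hK, trivial⟩
  exact .div (.mul (.mul h h) (.mul h h)) (uses_vertexCountE hK)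

theorem uses_incidentE (hK : R K) {φ y : Ex} (hφ : φ.Uses R X) (hy : y.Uses R X) :
    ∀ j, (incidentE K r φ y j).Uses R X
  | 0 => trivial
  | j + 1 => ⟨uses_incidentE hK hφ hy j, .eq ⟨hK, ⟨trivial, .mul hφ trivial⟩, trivial⟩ hy⟩

theorem uses_inCountE (hK : R K) : (inCountE K).Uses R X :=
  ⟨uses_edgeCountE hK, uses_edgeCountE hK, uses_thresholdE hK, uses_thresholdE hK⟩

theorem uses_lengthE (hK : R K) : (lengthE K).Uses R X :=
  ⟨⟨trivial, .mul (uses_inCountE hK) ⟨uses_edgeCountE hK, trivial⟩⟩,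
    .mul (uses_vertexCountE hK) ⟨uses_edgeCountE hK, trivial⟩⟩

theorem uses_entryE (hK : R K) {j : Ex} (hj : j.Uses R X) : (entryE K r j).Uses R X := by
  have hW : (widthE K).Uses R X := ⟨uses_edgeCountE hK, trivial⟩
  have hj1 : (Ex.sub j (.lit 9)).Uses R X := ⟨hj, trivial⟩
  have hA := Uses.mul (uses_inCountE hK) hW
  have hj2 : (Ex.sub (.sub j (.lit 9)) (mul (inCountE K) (widthE K))).Uses R X := ⟨hj1, hA⟩
  have hout : (outEntryE K r (.sub (.sub j (.lit 9)) (mul (inCountE K) (widthE K)))).Uses R X :=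
    ⟨.le (e := .add _ _) ⟨.mod hj2 hW, trivial⟩ (uses_edgeCountE hK), trivial,
      uses_incidentE hK (.mod hj2 hW) (.div hj2 hW) r, trivial, trivial⟩
  have hin : (inEntryE K (.sub j (.lit 9))).Uses R X :=
    .eq (f := .ite _ _ _) (.mod hj1 hW)
      ⟨.le (.div hj1 hW) (uses_edgeCountE hK), uses_edgeCountE hK, .div hj1 hW⟩
  refine Uses.select (rest := .ite _ _ _)
    ⟨.le (e := .add _ (.lit 1)) ⟨hj1, trivial⟩ hA, hout, hin⟩ ?_ hj
  simp [hW, uses_inCountE hK, uses_vertexCountE hK, Uses]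

theorem uses_coveredE (hK : R K) (hK' : R (K + 1)) : (coveredE K r).Uses R X :=
  ⟨uses_vertexCountE hK, ⟨uses_edgeCountE hK, ⟨hK', Or.inl rfl⟩, trivial,
    uses_incidentE hK (by exact Or.inl rfl) (by exact Or.inr (Or.inl rfl)) r⟩,
    trivial, trivial⟩

theorem uses_answerE (hK : R K) (hK' : R (K + 1)) : (answerE K r).Uses R X :=
  ⟨⟨hK, trivial⟩, trivial,
    .le (uses_edgeCountE hK) (.mul (uses_vertexCountE hK) (uses_vertexCountE hK)), trivial,
    .le (uses_thresholdE hK) (uses_coveredE hK hK'), trivial, trivial⟩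

end Ex

end RAM

namespace RAM

/-! ### The program of the reduction -/

/-- The state that agrees with `s` below `K` and with `u` from `K` on. -/
def State.merge (K : ℕ) (s u : State) : State where
  var x := if x < K then s.var x else u.var x
  arr a := if a < K then s.arr a else u.arr a

/-- A program with names below `K` may be used as a subroutine. -/
theorem Exec.runsTo {c : Cmd} {s s' u : State} {t K d : ℕ} (h : Exec c s t s')
    (hc : c.NamesLt K) (hK : K ≤ d) (hu : s.AgreeOn (· < K) (· < K) u) :
    RunsTo d c u t (State.merge K s' u) := by
  intro v hv
  obtain ⟨v', e, a, b⟩ := h.frame hc v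
    (hu.trans (hv.mono (fun x (hx : x < K) => hx.trans_le hK) fun _ _ => trivial).symm)
  refine ⟨t, le_rfl, v', e, fun x hx => ?_, fun x _ => ?_⟩
  · by_cases hxK : x < K
    · simpa [State.merge, hxK] using (a.1 x hxK).symm
    · simpa [State.merge, hxK] using (b.1 x (not_lt.1 hxK)).symm.trans (hv.1 x hx)
  · by_cases hxK : x < K
    · simpa [State.merge, hxK] using (a.2 x hxK).symm
    · simpa [State.merge, hxK] using (b.2 x (not_lt.1 hxK)).symm.trans (hv.2 x trivial)

theorem inputSize_le {w : List ℕ} {B : ℕ} (h : ∀ j, j < w.length → w.getD j 0 ≤ B) :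
    inputSize w ≤ w.length * (B + 1) := by
  rw [inputSize]
  refine (List.sum_le_card_nsmul _ (B + 1) fun x hx => ?_).trans (by simp)
  obtain ⟨y, hy, rfl⟩ := List.mem_map.1 hx
  obtain ⟨j, hj, rfl⟩ := List.mem_iff_getElem.1 hy
  have h1 := h j hj
  rw [List.getD_eq_getElem _ _ hj] at h1
  have h2 : Nat.size w[j] ≤ w[j] := Nat.size_le.2 Nat.lt_two_pow_self
  omega

theorem length_le_inputSize (w : List ℕ) : w.length ≤ inputSize w := by
  rw [inputSize]
  simp

/-- Clean the input, write the encoding of the certificate-selection instance into array `0`, run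
the approximation algorithm `c`, and derive the answer from its output. The arrays `K` and `K + 1`
and the variables from `K` on are not used by `c`. -/
def reduction (c : Cmd) (K d r : ℕ) : Cmd :=
  .seq (fill d K K (.var 0) (Ex.cleanedE (.var K)))
  (.seq (fill d 0 K (.var 0) (.lit 0))
  (.seq (fill d 0 K (Ex.lengthE K) (Ex.entryE K r (.var K)))
  (.seq (assign d 0 (Ex.lengthE K))
  (.seq c
  (.seq (fill d (K + 1) K (Ex.edgeCountE K) (.arr 0 (.var K)))
  (.seq (fill d 0 K (.lit 1) (Ex.answerE K r))
  (assign d 0 (.lit 1))))))))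

theorem Ex.eval_cleanedE {r : ℕ} {I : DenseVsRandomInput r} {j : Ex} {s : State}
    (h : ∀ i, s.arr 0 i = I.cell i) : (Ex.cleanedE j).eval s = I.cleaned (j.eval s) := by
  simp only [Ex.cleanedE, Ex.eval, h, I.cell_zero, I.cell_one, I.cell_two,
    DenseVsRandomInput.cleaned]
  split_ifs <;> first | rfl | omega

theorem Ex.cost_cleanedE_le (x : ℕ) (s : State) : (Ex.cleanedE (.var x)).cost s ≤ 20 := by
  simp only [Ex.cleanedE, Ex.cost]
  split_ifs <;> omega

theorem cleaned_le_inputSize {r : ℕ} (hr : 0 < r) (I : DenseVsRandomInput r) (j : ℕ) :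
    I.cleaned j ≤ inputSize I.encode := by
  refine (I.cleaned_le j).trans (le_trans ?_ (length_le_inputSize _))
  rw [I.length_encode]
  nlinarith

theorem cleaned_eq_zero {r : ℕ} (I : DenseVsRandomInput r) {j : ℕ} (hj : I.encode.length ≤ j) :
    I.cleaned j = 0 := by
  rw [DenseVsRandomInput.cleaned, DenseVsRandomInput.cell, List.getD_eq_default _ _ hj, ite_self]

/-- If `f` computes verifiers in polynomial time, the answers derived from them are computable in
polynomial time as well. Values left behind by the subroutine may be exponentially large, so only
the accepted bits are copied out of array `0` before anything is computed from them. -/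
theorem polyTimeComputable_answer {r : ℕ} (hr : 0 < r) {f : DCS2Instance → List ℕ}
    (hf : PolyTimeComputable DCS2Instance.encode f)
    (A : ∀ I : DenseVsRandomInput r, Fin (edgeCount I.cleaned + 1) → Bool)
    (hA : ∀ I : DenseVsRandomInput r,
      f (wordInstance r I.cleaned) = DCS2Instance.encodeVerifier (A I)) :
    PolyTimeComputable DenseVsRandomInput.encode
      fun I : DenseVsRandomInput r => [(answer r I.cleaned (A I)).toNat] := by
  obtain ⟨c, pc, hc⟩ := hf
  obtain ⟨K₀, hK₀⟩ := c.exists_namesLt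
  obtain ⟨K, hcK, hK1⟩ : ∃ K, c.NamesLt K ∧ 1 ≤ K := ⟨K₀ + 1, hK₀.mono (Nat.le_succ _), by omega⟩
  obtain ⟨d, hd, d1, d2, d3, d4, d5⟩ : ∃ d, K + 3 ≤ d ∧ (Ex.cleanedE (.var K)).Below d ∧
      (Ex.lengthE K).Below d ∧ (Ex.entryE K r (.var K)).Below d ∧ (Ex.edgeCountE K).Below d ∧
      (Ex.answerE K r).Below d :=
    ⟨K + 3 + (Ex.cleanedE (.var K)).bound + (Ex.lengthE K).bound + (Ex.entryE K r (.var K)).bound +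
      (Ex.edgeCountE K).bound + (Ex.answerE K r).bound, by omega,
      Ex.below_of_bound_le (by omega), Ex.below_of_bound_le (by omega),
      Ex.below_of_bound_le (by omega), Ex.below_of_bound_le (by omega),
      Ex.below_of_bound_le (by omega)⟩
  -- polynomial bounds for all the expressions that contain loops
  obtain ⟨qL, hqL⟩ := Ex.exists_poly_bound (R := (· = K)) (X := fun _ => False)
    (Ex.uses_lengthE (K := K) rfl)
  have hentry : (Ex.entryE K r (.var K)).Uses (· = K) (· = K) :=
    Ex.uses_entryE (R := (· = K)) rfl (show (Ex.var K).Uses (· = K) (· = K) from rfl)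
  obtain ⟨qW, hqW⟩ := Ex.exists_poly_bound hentry
  obtain ⟨qM, hqM⟩ := Ex.exists_poly_bound (R := (· = K)) (X := fun _ => False)
    (Ex.uses_edgeCountE (K := K) rfl)
  obtain ⟨qA, hqA⟩ := Ex.exists_poly_bound (R := fun a => a = K ∨ a = K + 1) (X := fun _ => False)
    (Ex.uses_answerE (K := K) (r := r) (.inl rfl) (.inr rfl))
  -- the cell index in the entries ranges up to the length of the encoding
  set qW' : Polynomial ℕ := qW.comp (Polynomial.X + qL) with hqW'
  refine ⟨reduction c K d r,
    (2 + Polynomial.X * 27 + 6) + ((2 + Polynomial.X * 8 + 6) + ((qL + qL * (qW' + 7) + 6) +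
      ((qL + 2) + (pc.comp (qL * (qW' + 1)) + ((qM + qM * 10 + 6) +
        ((1 + (qA.comp (Polynomial.X + 1) + 7) + 6) + 3)))))), fun I => ?_⟩
  set w := I.encode with hw
  set V := inputSize w with hV
  have hwV : w.length ≤ V := length_le_inputSize w
  set G := wordInstance r I.cleaned with hG
  set s0 := initState w with hs0
  have r1 := runsTo_fill (d := d) (a := K) (x := K) (l := .var 0) (e := Ex.cleanedE (.var K))
    (X := (· = K)) (R := (· = 0)) (by omega) (show 0 < d by omega) d1
    (by simp [Ex.cleanedE, Ex.Uses]) (by omega) s0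
  have ev0 : (Ex.var 0).eval s0 = w.length := by simp [Ex.eval, hs0, initState]
  rw [ev0] at r1
  set s1 := s0.fill K K w.length (Ex.cleanedE (.var K)) with hs1
  have s1K : s1.arr K = I.cleaned := by
    funext j
    have hcell : ∀ i, (s0.setVar K j).arr 0 i = I.cell i := fun i => by
      simp [hs0, initState, DenseVsRandomInput.cell, hw]
    simp only [hs1, State.fill, Function.update_self]
    split_ifs with hj
    · rw [Ex.eval_cleanedE hcell]; simp [Ex.eval]
    · rw [cleaned_eq_zero I (not_lt.1 hj)]
      simp [hs0, initState, show K ≠ 0 by omega]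
  have r2 := runsTo_fill (d := d) (a := 0) (x := K) (l := .var 0) (e := .lit 0)
    (X := fun _ => False) (R := fun _ => False) (by omega) (show 0 < d by omega) trivial
    trivial (by simp) s1
  have ev1 : (Ex.var 0).eval s1 = w.length := ev0
  rw [ev1] at r2
  set s2 := s1.fill 0 K w.length (.lit 0) with hs2
  have s2K : s2.arr K = I.cleaned := by
    rw [← s1K]; simp [hs2, State.fill, show K ≠ 0 by omega]
  have s20 : s2.arr 0 = fun _ => 0 := by
    funext j
    simp only [hs2, hs1, State.fill, Function.update_self, Ex.eval,
      Function.update_of_ne (show 0 ≠ K by omega)]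
    split_ifs with hj
    · rfl
    · simp [hs0, initState, List.getElem?_eq_none (not_lt.1 hj)]
  have hB2 : ∀ s : State, s.arr K = I.cleaned → ∀ a, a = K → ∀ i, s.arr a i ≤ V := by
    rintro s hs a rfl i
    rw [hs]
    exact cleaned_le_inputSize hr I i
  have r3 := runsTo_fill (d := d) (a := 0) (x := K) (l := Ex.lengthE K)
    (e := Ex.entryE K r (.var K)) (by omega) d2 d3 hentry (by omega) s2
  have ev2 : (Ex.lengthE K).eval s2 = G.encode.length := by
    rw [Ex.eval_lengthE (r := r), s2K]
  have hL := hqL s2 V (fun _ h => h.elim) (hB2 s2 s2K)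
  rw [ev2] at r3 hL
  set s3 := s2.fill 0 K G.encode.length (Ex.entryE K r (.var K)) with hs3
  have s3K : s3.arr K = I.cleaned := by
    rw [← s2K]; simp [hs3, State.fill, show K ≠ 0 by omega]
  have hW : ∀ j < G.encode.length, (Ex.entryE K r (.var K)).eval (s2.setVar K j) =
      G.encode.getD j 0 ∧ (Ex.entryE K r (.var K)).eval (s2.setVar K j) ≤ qW'.eval V ∧
      (Ex.entryE K r (.var K)).cost (s2.setVar K j) ≤ qW'.eval V := by
    intro j hj
    have hjv : (Ex.var K).eval (s2.setVar K j) = j := by simp [Ex.eval]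
    have h1 := Ex.eval_entryE (K := K) (r := r) (s := s2.setVar K j) (.var K)
      (by rw [hjv, State.setVar_arr, s2K]; exact hj)
    rw [hjv, State.setVar_arr, s2K] at h1
    have h2 := hqW (s2.setVar K j) (V + qL.eval V)
      (by rintro x rfl; simp; omega)
      (fun a ha i => (hB2 (s2.setVar K j) s2K a ha i).trans (Nat.le_add_right _ _))
    rw [hqW', Polynomial.eval_comp, Polynomial.eval_add, Polynomial.eval_X]
    exact ⟨h1, h2⟩
  have s30 : s3.arr 0 = fun j => G.encode.getD j 0 := by
    funext j
    simp only [hs3, State.fill, Function.update_self]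
    split_ifs with hj
    · exact (hW j hj).1
    · rw [s20, List.getD_eq_default _ _ (not_lt.1 hj)]
  have r4 := runsTo_assign (d := d) (x := 0) (by omega) d2 s3
  have ev3 : (Ex.lengthE K).eval s3 = G.encode.length := by
    rw [Ex.eval_lengthE (r := r), s3K]
  have hL3 := hqL s3 V (fun _ h => h.elim) (hB2 s3 s3K)
  rw [ev3] at r4
  set s4 := s3.setVar 0 G.encode.length with hs4
  -- the state in which the subroutine is started is its initial state on the encoded instance
  have hinit : (initState G.encode).AgreeOn (· < K) (· < K) s4 := by
    refine ⟨fun x hx => ?_, fun a ha => ?_⟩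
    · by_cases hx0 : x = 0
      · simp [initState, hs4, hx0]
      · simp [initState, hs4, hx0, hs3, hs2, hs1, hs0, State.fill]
    · by_cases ha0 : a = 0
      · subst ha0
        rw [hs4, State.setVar_arr, s30]
        funext j; simp [initState]
      · have haK : a ≠ K := by omega
        funext j
        simp [initState, hs4, ha0, hs3, hs2, hs1, hs0, State.fill, haK]
  obtain ⟨t, sc, ht, hexec, hout⟩ := hc G
  have r5 := hexec.runsTo hcK (show K ≤ d by omega) hinit
  set s5 := State.merge K sc s4 with hs5
  have s5K : s5.arr K = I.cleaned := by
    rw [← s3K]; simp [hs5, State.merge, hs4]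
  have s50 : s5.arr 0 = sc.arr 0 := by
    simp [hs5, State.merge, show 0 < K by omega]
  have s5K1 : ∀ j, s5.arr (K + 1) j = 0 := fun j => by
    simp [hs5, State.merge, hs4, hs3, hs2, hs1, hs0, State.fill, initState]
  have hsc : ∀ φ (h : φ < edgeCount I.cleaned), sc.arr 0 φ = (A I ⟨φ, by omega⟩).toNat := by
    have h1 : sc.output = DCS2Instance.encodeVerifier (A I) := hout.trans (hA I)
    have h2 := congrArg List.length h1
    simp only [State.output, DCS2Instance.encodeVerifier, List.length_map, List.length_range,
      List.length_ofFn] at h2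
    intro φ h
    have h3 := congrArg (fun l => l[φ]?) h1
    simpa [State.output, DCS2Instance.encodeVerifier, h2, -List.ofFn_succ,
      show φ < edgeCount I.cleaned + 1 by omega] using h3
  have r6 := runsTo_fill (d := d) (a := K + 1) (x := K) (l := Ex.edgeCountE K)
    (e := .arr 0 (.var K)) (X := (· = K)) (R := (· = 0)) (by omega) d4 (show K < d by omega)
    ⟨rfl, by exact rfl⟩ (by omega) s5
  have ev5 : (Ex.edgeCountE K).eval s5 = edgeCount I.cleaned := by
    rw [Ex.eval_edgeCountE, s5K]
  have hM := hqM s5 V (fun _ h => h.elim) (hB2 s5 s5K)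
  rw [ev5] at r6 hM
  set s6 := s5.fill (K + 1) K (edgeCount I.cleaned) (.arr 0 (.var K)) with hs6
  have s6K : s6.arr K = I.cleaned := by
    rw [← s5K]; simp [hs6, State.fill]
  have s6K1 : ∀ φ, s6.arr (K + 1) φ = if φ < edgeCount I.cleaned then sc.arr 0 φ else 0 := by
    intro φ
    simp [hs6, State.fill, Ex.eval, s50, s5K1]
  have r7 := runsTo_fill (d := d) (a := 0) (x := K) (l := .lit 1) (e := Ex.answerE K r)
    (X := fun _ => False) (R := fun a => a = K ∨ a = K + 1) (by omega) trivial d5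
    (Ex.uses_answerE (.inl rfl) (.inr rfl)) (by omega) s6
  have hA6 := hqA (s6.setVar K 0) (V + 1) (fun _ h => h.elim) (by
    rintro a (rfl | rfl) i
    · exact (hB2 (s6.setVar a 0) s6K a rfl i).trans (Nat.le_succ _)
    · rw [State.setVar_arr, s6K1]
      split_ifs with h
      · rw [hsc i h]
        have := Bool.toNat_le (A I ⟨i, by omega⟩)
        omega
      · omega)
  have hans : (Ex.answerE K r).eval (s6.setVar K 0) = (answer r I.cleaned (A I)).toNat := by
    have key : ∀ (B : ℕ → ℕ) (hB : (s6.setVar K 0).arr K = B) (A' : Fin (edgeCount B + 1) → Bool),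
        (∀ φ (h : φ < edgeCount B), s6.arr (K + 1) φ = (A' ⟨φ, by omega⟩).toNat) →
        (Ex.answerE K r).eval (s6.setVar K 0) = (answer r B A').toNat := by
      rintro B rfl A' h
      exact Ex.eval_answerE h
    refine key I.cleaned s6K (A I) fun φ h => ?_
    rw [s6K1, if_pos h, hsc φ h]
  have r8 := runsTo_assign (d := d) (x := 0) (e := .lit 1) (by omega) trivial
    (s6.fill 0 K ((Ex.lit 1).eval s6) (Ex.answerE K r))
  obtain ⟨T, hT, u, hexec, hu⟩ := (r1.seq (r2.seq (r3.seq (r4.seq (r5.seq (r6.seq (r7.seq r8)))))))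
    s0 (.refl s0)
  refine ⟨T, u, hT.trans ?_, hexec, ?_⟩
  · have b1 : ∑ j ∈ Finset.range w.length, ((Ex.cleanedE (.var K)).cost (s0.setVar K j) + 7) ≤
        V * 27 := by
      refine (Finset.sum_le_card_nsmul _ _ 27 fun j _ => ?_).trans ?_
      · have := Ex.cost_cleanedE_le K (s0.setVar K j)
        omega
      · rw [Finset.card_range, smul_eq_mul]
        exact Nat.mul_le_mul_right _ hwV
    have b2 : ∑ j ∈ Finset.range w.length, ((Ex.lit 0).cost (s1.setVar K j) + 7) ≤ V * 8 := by
      simp only [Ex.cost, Finset.sum_const, Finset.card_range, smul_eq_mul]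
      exact Nat.mul_le_mul_right _ hwV
    have b3 : ∑ j ∈ Finset.range G.encode.length,
        ((Ex.entryE K r (.var K)).cost (s2.setVar K j) + 7) ≤ qL.eval V * (qW'.eval V + 7) := by
      refine (Finset.sum_le_card_nsmul _ _ (qW'.eval V + 7) fun j hj => ?_).trans ?_
      · have := (hW j (Finset.mem_range.1 hj)).2.2
        omega
      · rw [Finset.card_range, smul_eq_mul]
        exact Nat.mul_le_mul_right _ hL.1
    have b5 : t ≤ pc.eval (qL.eval V * (qW'.eval V + 1)) := by
      refine ht.trans (eval_mono_nat _ ?_)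
      refine (inputSize_le fun j hj => ?_).trans (Nat.mul_le_mul_right _ hL.1)
      rw [← (hW j hj).1]
      exact (hW j hj).2.1
    have b6 : ∑ j ∈ Finset.range (edgeCount I.cleaned),
        ((Ex.arr 0 (.var K)).cost (s5.setVar K j) + 7) ≤ qM.eval V * 10 := by
      simp only [Ex.cost, Finset.sum_const, Finset.card_range, smul_eq_mul]
      exact Nat.mul_le_mul_right _ hM.1
    have b7 : ∑ j ∈ Finset.range ((Ex.lit 1).eval s6),
        ((Ex.answerE K r).cost (s6.setVar K j) + 7) ≤ qA.eval (V + 1) + 7 := by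
      simpa [Ex.eval] using hA6.2
    simp only [Polynomial.eval_add, Polynomial.eval_mul, Polynomial.eval_X, Polynomial.eval_comp,
      Polynomial.eval_ofNat, Polynomial.eval_one]
    refine Nat.add_le_add ?_ (Nat.add_le_add ?_ (Nat.add_le_add ?_ (Nat.add_le_add ?_
      (Nat.add_le_add b5 (Nat.add_le_add ?_ (Nat.add_le_add ?_ ?_))))))
    · exact Nat.add_le_add_right (Nat.add_le_add le_rfl b1) 6
    · exact Nat.add_le_add_right (Nat.add_le_add le_rfl b2) 6
    · exact Nat.add_le_add_right (Nat.add_le_add hL.2 b3) 6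
    · exact Nat.add_le_add_right hL3.2 2
    · exact Nat.add_le_add_right (Nat.add_le_add hM.2 b6) 6
    · exact Nat.add_le_add_right (Nat.add_le_add le_rfl b7) 6
    · exact le_rfl
  · have h0 : u.var 0 = 1 := by
      rw [hu.1 0 (by omega)]; simp [Ex.eval]
    have h1 : u.arr 0 0 = (answer r I.cleaned (A I)).toNat := by
      rw [hu.2 0 trivial, ← hans]; simp [State.fill, Ex.eval]
    rw [State.output, h0]
    simp [h1]

end RAM

/-! ### Hardness of approximation -/

theorem accepted_subset {M : ℕ} (A : Fin (M + 1) → Bool) : accepted A ⊆ Finset.range M :=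
  Finset.filter_subset _ _

namespace DenseVsRandomInput

variable {r : ℕ} {I : DenseVsRandomInput r}

theorem cleaned_eq_cell (h : 1 ≤ I.n ∧ I.n ≤ I.H.card ∧ I.k ≤ I.n) : I.cleaned = I.cell :=
  funext fun _ => if_pos h

theorem vertexCount_cleaned (h : 1 ≤ I.n ∧ I.n ≤ I.H.card ∧ I.k ≤ I.n) :
    vertexCount I.cleaned = I.n := by
  rw [cleaned_eq_cell h, vertexCount, I.cell_zero, if_neg (by omega)]

theorem edgeCount_cleaned (h : 1 ≤ I.n ∧ I.n ≤ I.H.card ∧ I.k ≤ I.n) :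
    edgeCount I.cleaned = I.H.card := by
  rw [cleaned_eq_cell h, edgeCount, I.cell_two, if_neg (by omega)]

theorem wordThreshold_cleaned (h : 1 ≤ I.n ∧ I.n ≤ I.H.card ∧ I.k ≤ I.n) {θ : ℝ}
    (hk : I.k = plantedSize θ I.n) : wordThreshold I.cleaned = threshold θ I.n := by
  rw [wordThreshold, vertexCount_cleaned h, cleaned_eq_cell h, I.cell_one, threshold, hk]
  ring_nf

/-- If any `p` edges cover at least `p` vertices, then every admissible verifier leads to the
answer "random". -/
theorem answer_eq_false {θ : ℝ} (h : 1 ≤ I.n ∧ I.n ≤ I.H.card ∧ I.k ≤ I.n)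
    (hk : I.k = plantedSize θ I.n) (hp : 2 * threshold θ I.n ≤ I.n)
    (hsq : I.H.card ≤ I.n * I.n)
    (hU : ∀ U : Finset (Fin I.n), threshold θ I.n ≤ (I.H.edgesIn U).card →
      threshold θ I.n ≤ U.card)
    {A : Fin (edgeCount I.cleaned + 1) → Bool} (hA : (wordInstance r I.cleaned).Feasible A) :
    answer r I.cleaned A = false := by
  have hacc : wordThreshold I.cleaned ≤ (accepted A).card :=
    le_card_accepted_of_feasible
      (by rw [wordThreshold_cleaned h hk, edgeCount_cleaned h]; omega) hA
  have hsub := accepted_subset A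
  rw [answer]
  generalize accepted A = F at hacc hsub ⊢
  refine decide_eq_false ?_
  rw [wordThreshold_cleaned h hk] at hacc ⊢
  rw [edgeCount_cleaned h] at hsub ⊢
  rw [vertexCount_cleaned h, cleaned_eq_cell h, I.cell_zero]
  obtain ⟨U, hU1, hU2⟩ := I.card_le_edgesIn F hsub
  have := hU U (hacc.trans hU2)
  omega

/-- The verifier that accepts the edges inside `S`, and the certificate without out-class
neighbours. -/
def insideVerifier (I : DenseVsRandomInput r) (S : Finset (Fin I.n)) (M : ℕ) (φ : Fin (M + 1)) :
    Bool :=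
  decide (φ.val = M ∨ I.H.edgeAt φ ⊆ S)

theorem accepted_insideVerifier (S : Finset (Fin I.n)) (M : ℕ) :
    accepted (I.insideVerifier S M) = (Finset.range M).filter fun φ => I.H.edgeAt φ ⊆ S := by
  ext φ
  simp only [accepted, insideVerifier, Finset.mem_filter, Finset.mem_range, decide_eq_true_eq]
  constructor
  · rintro ⟨h, _, h' | h'⟩
    · omega
    · exact ⟨h, h'⟩
  · rintro ⟨h, h'⟩
    exact ⟨h, by omega, .inr h'⟩

/-- If the edges inside some `S` with `|S| = k` number at least `p`, then a verifier that is
optimal up to a factor below `p / k` leads to the answer "dense". -/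
theorem answer_eq_true {θ b : ℝ} (hk : I.k = plantedSize θ I.n)
    (hp : 2 * threshold θ I.n ≤ I.n) (S : Finset (Fin I.n)) (hS : S.card = I.k)
    (hSp : threshold θ I.n ≤ (I.H.edgesIn S).card)
    (hb : b * I.k < threshold θ I.n) (hb0 : 0 ≤ b)
    {A : Fin (edgeCount I.cleaned + 1) → Bool}
    (hA : I.n ≤ I.H.card → I.H.card ≤ I.n * I.n →
      ∀ A' : Fin (edgeCount I.cleaned + 1) → Bool, (wordInstance r I.cleaned).Feasible A' →
      1 - ((wordInstance r I.cleaned).G.soundness A : ℝ) ≤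
        b * (1 - ((wordInstance r I.cleaned).G.soundness A' : ℝ))) :
    answer r I.cleaned A = true := by
  rw [answer]
  refine decide_eq_true ?_
  by_cases h : 1 ≤ I.n ∧ I.n ≤ I.H.card ∧ I.k ≤ I.n
  swap
  · exact .inl (if_neg h)
  by_cases hsq : vertexCount I.cleaned * vertexCount I.cleaned < edgeCount I.cleaned
  · exact .inr (.inl hsq)
  refine .inr (.inr ?_)
  have hthr := wordThreshold_cleaned h hk
  have hfeas : (wordInstance r I.cleaned).Feasible (I.insideVerifier S (edgeCount I.cleaned)) := by
    refine gapInstance_feasible_of_le ?_ ?_ ?_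
    · rw [hthr, edgeCount_cleaned h]; omega
    · rw [accepted_insideVerifier, hthr, edgeCount_cleaned h, ← I.H.card_edgesIn]
      exact hSp
    · simp [insideVerifier]
  rw [vertexCount_cleaned h, edgeCount_cleaned h, not_lt] at hsq
  have hle := hA h.2.1 hsq _ hfeas
  have e1 := one_sub_soundness_gapInstance (P := wordThreshold I.cleaned)
    (hN := vertexCount_pos I.cleaned) (hM := edgeCount_pos I.cleaned) (T := Incident r I.cleaned) A
  have e2 := one_sub_soundness_gapInstance (P := wordThreshold I.cleaned)
    (hN := vertexCount_pos I.cleaned) (hM := edgeCount_pos I.cleaned) (T := Incident r I.cleaned)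
    (I.insideVerifier S (edgeCount I.cleaned))
  have hle' : ((covered (vertexCount I.cleaned) (Incident r I.cleaned) (accepted A)).card : ℝ) /
      (vertexCount I.cleaned : ℝ) ≤ b * (((covered (vertexCount I.cleaned) (Incident r I.cleaned)
        (accepted (I.insideVerifier S (edgeCount I.cleaned)))).card : ℝ) /
          (vertexCount I.cleaned : ℝ)) := by
    rw [← e1, ← e2]; exact hle
  have hn : (0 : ℝ) < vertexCount I.cleaned := by exact_mod_cast vertexCount_pos I.cleaned
  rw [← mul_div_assoc, div_le_div_iff_of_pos_right hn, accepted_insideVerifier] at hle'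
  have hcov : (covered (vertexCount I.cleaned) (Incident r I.cleaned)
      ((Finset.range (edgeCount I.cleaned)).filter fun φ => I.H.edgeAt φ ⊆ S)).card ≤ I.k := by
    rw [vertexCount_cleaned h, edgeCount_cleaned h, cleaned_eq_cell h, ← hS]
    exact I.card_covered_le S
  have hcov' : b * ((covered (vertexCount I.cleaned) (Incident r I.cleaned)
      ((Finset.range (edgeCount I.cleaned)).filter fun φ => I.H.edgeAt φ ⊆ S)).card : ℝ) ≤
      b * I.k := mul_le_mul_of_nonneg_left (by exact_mod_cast hcov) hb0
  rw [hthr]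
  exact_mod_cast hle'.trans_lt (hcov'.trans_lt hb)

end DenseVsRandomInput

/-- A set of `k` vertices with average degree at least `k ^ β` contains at least `p` edges, once
`r * p ≤ k ^ (1 + β)`. -/
theorem UniformHypergraph.le_card_edgesIn {r n k p : ℕ} {β : ℝ} (hr : 0 < r) (hk : 0 < k)
    (H : UniformHypergraph r n) (S : Finset (Fin n)) (hS : S.card = k)
    (hd : (k : ℝ) ^ β ≤ H.avgDegree S) (hp : (r * p : ℝ) ≤ (k : ℝ) ^ (1 + β)) :
    p ≤ (H.edgesIn S).card := by
  have hk' : (0 : ℝ) < k := by exact_mod_cast hk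
  have hr' : (0 : ℝ) < r := by exact_mod_cast hr
  rw [H.avgDegree_eq, hS, le_div_iff₀ hk', ← Real.rpow_add_one hk'.ne', add_comm] at hd
  have := hp.trans hd
  push_cast at this
  exact_mod_cast le_of_mul_le_mul_left this hr'

theorem mainTheorem2 (hconj : HypergraphDenseVsRandomConjecture) (ε : ℝ) (hε : 0 < ε)
    (g : ℕ → ℝ) (hg : g =O[atTop] fun m : ℕ => (m : ℝ) ^ (1 / 4 - ε)) :
    ¬ DCS2Instance.PolyTimeApproximable g := by
  rintro ⟨f, hf, happ⟩
  -- replacing `ε` by `2 * θ ≤ 1 / 8` keeps the exponent `1 / 4 - 2 * θ` positive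
  obtain ⟨θ, hθ0, hθ, hθε⟩ : ∃ θ : ℝ, 0 < θ ∧ θ ≤ 1 / 16 ∧ 2 * θ ≤ ε :=
    ⟨min (ε / 2) (1 / 16), by positivity, min_le_right _ _, by
      have := min_le_left (ε / 2) (1 / 16); linarith⟩
  obtain ⟨C, hC, hgC⟩ := hg.exists_nonneg
  have hgC := hgC.bound
  -- `4 * θ * r ≥ 3` makes the exponent `n * ρ * p ^ r` in the union bound at most `1`
  obtain ⟨r, hr⟩ := exists_nat_ge (3 / (4 * θ))
  rw [div_le_iff₀ (by linarith)] at hr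
  have hr12 : (12 : ℝ) ≤ r := by
    by_contra hlt
    push Not at hlt
    nlinarith
  have hr2 : 2 ≤ r := by
    have : (2 : ℝ) ≤ r := by linarith
    exact_mod_cast this
  have hfeas : ∀ I : DenseVsRandomInput r, ∃ A', (wordInstance r I.cleaned).Feasible A' :=
    fun I => ⟨_, gapInstance_feasible_true⟩
  choose A hAf hAfeas hAopt using fun I : DenseVsRandomInput r => happ _ (hfeas I)
  have hpar := eventually_parameters hθ0 hθ r C hC
  refine hconj r (1 - 3 * θ) (1 - 4 * θ) (1 / 2 - θ) (by linarith) (by linarith) (by linarith)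
    (by linarith) (by linarith) (by nlinarith)
    ⟨fun I => answer r I.cleaned (A I),
      RAM.polyTimeComputable_answer (by omega) hf A hAf, ?_, ?_⟩
  · have hspread := UniformHypergraph.tendsto_randomProb_spread (r := r) (α := 1 - 3 * θ)
      (δ := 4 * θ) hr2 (by linarith) (by linarith) (by linarith) (by linarith) (threshold θ)
      (hpar.mono fun n h => h.1)
      ((eventually_ge_atTop 1).mono fun n hn => threshold_le hn)
    have hρ : ∀ᶠ n : ℕ in atTop, 0 ≤ (n : ℝ) ^ (1 - 3 * θ - ((r : ℝ) - 1)) ∧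
        (n : ℝ) ^ (1 - 3 * θ - ((r : ℝ) - 1)) ≤ 1 := by
      filter_upwards [eventually_ge_atTop 1] with n hn
      exact ⟨by positivity, Real.rpow_le_one_of_one_le_of_nonpos (by exact_mod_cast hn)
        (by linarith)⟩
    refine tendsto_of_tendsto_of_tendsto_of_le_of_le' hspread tendsto_const_nhds ?_ ?_
    · filter_upwards [hρ, hpar, eventually_ge_atTop 1] with n ⟨h0, h1⟩ hp hn
      refine UniformHypergraph.randomProb_mono h0 h1 fun H hH => ?_
      exact DenseVsRandomInput.answer_eq_false (I := ⟨n, plantedSize θ n, H⟩) (θ := θ)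
        ⟨hn, hH.1, hp.2.2.1⟩ rfl hp.2.1 hH.2.1 hH.2.2 (hAfeas _)
    · filter_upwards [hρ] with n ⟨h0, h1⟩
      have h2 := UniformHypergraph.randomProb_add_not (r := r) (n := n)
        ((n : ℝ) ^ (1 - 3 * θ - ((r : ℝ) - 1))) fun H =>
          answer r (DenseVsRandomInput.cleaned ⟨n, ⌊(n : ℝ) ^ (1 / 2 - θ)⌋₊, H⟩)
            (A ⟨n, ⌊(n : ℝ) ^ (1 / 2 - θ)⌋₊, H⟩) = false
      have h3 := UniformHypergraph.randomProb_nonneg (r := r) (n := n) h0 h1 fun H =>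
          ¬ answer r (DenseVsRandomInput.cleaned ⟨n, ⌊(n : ℝ) ^ (1 / 2 - θ)⌋₊, H⟩)
            (A ⟨n, ⌊(n : ℝ) ^ (1 / 2 - θ)⌋₊, H⟩) = false
      linarith
  · obtain ⟨m₀, hm₀⟩ := eventually_atTop.1 hgC
    filter_upwards [hpar, eventually_ge_atTop (max 1 m₀)] with n hp hn H ⟨S, hS, hd⟩
    have hSp := H.le_card_edgesIn (by omega) hp.2.2.2.1 S hS hd hp.2.2.2.2.1
    refine DenseVsRandomInput.answer_eq_true (I := ⟨n, plantedSize θ n, H⟩) (θ := θ)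
      (b := C * ((n * n + 1 : ℕ) : ℝ) ^ (1 / 4 - 2 * θ)) rfl hp.2.1 S hS hSp
      hp.2.2.2.2.2 (by positivity) fun hnH hHn A' hA' => ?_
    refine (hAopt _ A' hA').trans ?_
    have hs : 0 ≤ 1 - ((wordInstance r (DenseVsRandomInput.cleaned
        ⟨n, plantedSize θ n, H⟩)).G.soundness A' : ℝ) := by
      refine le_of_le_of_eq ?_ (one_sub_soundness_gapInstance A').symm
      positivity
    refine mul_le_mul_of_nonneg_right ?_ hs
    have hm : (wordInstance r (DenseVsRandomInput.cleaned ⟨n, plantedSize θ n, H⟩)).m =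
        H.card + 1 := by
      refine congrArg (· + 1) (DenseVsRandomInput.edgeCount_cleaned
        (I := ⟨n, plantedSize θ n, H⟩) ⟨le_of_max_le_left hn, hnH, hp.2.2.1⟩)
    rw [hm]
    have hnH' : n ≤ H.card := hnH
    have hHn' : H.card ≤ n * n := hHn
    have h1 := hm₀ (H.card + 1) ((le_of_max_le_right hn).trans (by omega))
    rw [Real.norm_of_nonneg (Real.rpow_nonneg (Nat.cast_nonneg _) _)] at h1
    have hone : (1 : ℝ) ≤ ((H.card + 1 : ℕ) : ℝ) := by exact_mod_cast Nat.le_add_left 1 _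
    calc g (H.card + 1) ≤ C * ((H.card + 1 : ℕ) : ℝ) ^ (1 / 4 - ε) := (le_abs_self _).trans h1
      _ ≤ C * ((H.card + 1 : ℕ) : ℝ) ^ (1 / 4 - 2 * θ) := by
        gcongr
      _ ≤ C * ((n * n + 1 : ℕ) : ℝ) ^ (1 / 4 - 2 * θ) := by
        gcongr
        linarith

end
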